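/- Let $d\ge 1$, let $H$ be a real symmetric positive definite $d\times d$ matrix with smallest eigenvalue $m>0$, let $b_1\in\mathbb R^d$, $c_1\in\mathbb R$, and let $F(x)=\tfrac12 x^{T}Hx-b_1^{T}x+c_1$. Let $J$ be a real $d\times d$ matrix with $J^{T}=-J$, put $A_J=I+J$, and let $\beta>0$. Let $\lambda_1^J$ be the smallest real part of a complex eigenvalue of $A_JH$, and let $n_1$ be the largest size of a Jordan block, in the complex Jordan normal form of $A_JH$, whose eigenvalue has real part $\lambda_1^J$. Then there is a constant $C_J>0$, depending only on $J$ and $H$, such that, in the spectral norm, $$\left\|e^{-tA_JH}\right\|\le C_J\,(1+t^{n_1-1})\,e^{-t\lambda_1^J}\qquad\text{for all } t\ge 0 .\tag{1}$$ Moreover, let $C_J>0$ be any constant that satisfies (1), let $B$ be a standard $d$-dimensional Brownian motion, and let $X$ be a solution of $$dX(t)=-A_J\nabla F(X(t))\,dt+\sqrt{2\beta^{-1}}\,dB_t$$ with deterministic initial point $X(0)\in\mathbb R^d$. Let $\pi_{t,J}$ be the law of $X(t)$, and let $\pi(dx)\propto e^{-\beta F(x)}dx$ be the Gibbs measure. Then,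 for every $t\ge 0$, $$\mathcal W_2(\pi_{t,J},\pi)\le C_J\,(1+t^{n_1-1})\,e^{-t\lambda_1^J}\left(2\|X(0)\|^2+\frac4m\left(\frac{\|b_1\|^2}{2m}+\frac d\beta\right)\right)^{1/2},$$ where $\|\cdot\|$ on vectors is the Euclidean norm, $\mathcal W_2(\nu_1,\nu_2)=\inf\left(\mathbb E\|Y_1-Y_2\|^2\right)^{1/2}$, and the infimum is over all pairs of random vectors $(Y_1,Y_2)$ with $Y_1\sim\nu_1$ and $Y_2\sim\nu_2$. -/

import Mathlib

open MeasureTheory ProbabilityTheory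
open scoped NNReal ENNReal

namespace NonReversibleLangevin

noncomputable section

/-- The action of a real `d × d` matrix on the Euclidean space `ℝ^d`. -/
abbrev act {d : ℕ} (A : Matrix (Fin d) (Fin d) ℝ) :
    EuclideanSpace ℝ (Fin d) →L[ℝ] EuclideanSpace ℝ (Fin d) :=
  Matrix.toEuclideanCLM (𝕜 := ℝ) A

/-- The quadratic objective `F(x) = ½ xᵀ H x - bᵀ x + c`. -/
def quadObjective {d : ℕ} (H : Matrix (Fin d) (Fin d) ℝ) (b : EuclideanSpace ℝ (Fin d)) (c : ℝ)
    (x : EuclideanSpace ℝ (Fin d)) : ℝ :=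
  (1 / 2) * inner ℝ x (act H x) - inner ℝ b x + c

/-- The smallest eigenvalue of a real symmetric matrix. -/
def minEigenvalue {d : ℕ} (H : Matrix (Fin d) (Fin d) ℝ) : ℝ :=
  sInf (spectrum ℝ H)

/-- The matrix `A_J H = (I + J) H`. -/
def driftMatrix {d : ℕ} (H J : Matrix (Fin d) (Fin d) ℝ) : Matrix (Fin d) (Fin d) ℝ :=
  (1 + J) * H

/-- A real matrix, seen as a complex one. -/
abbrev toComplex {d : ℕ} (A : Matrix (Fin d) (Fin d) ℝ) : Matrix (Fin d) (Fin d) ℂ :=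
  A.map Complex.ofReal

/-- The smallest real part of a complex eigenvalue of a real matrix. -/
def minRealPart {d : ℕ} (A : Matrix (Fin d) (Fin d) ℝ) : ℝ :=
  sInf (Complex.re '' spectrum ℂ (toComplex A))

/-- The Jordan block of size `k` with eigenvalue `μ`. -/
def jordanBlock (μ : ℂ) (k : ℕ) : Matrix (Fin k) (Fin k) ℂ :=
  Matrix.of fun i j => if i = j then μ else if i.val + 1 = j.val then 1 else 0

/-- A Jordan normal form `S⁻¹ M S = diag(Ĵ₁, …, Ĵ_ℓ)` of a complex matrix `M`. -/
structure JordanForm {d : ℕ} (M : Matrix (Fin d) (Fin d) ℂ) where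
  /-- the number of blocks -/
  numBlocks : ℕ
  /-- the sizes of the blocks -/
  size : Fin numBlocks → ℕ
  /-- the eigenvalues of the blocks -/
  eigenvalue : Fin numBlocks → ℂ
  /-- the change of basis -/
  S : Matrix (Fin d) (Σ i, Fin (size i)) ℂ
  /-- the inverse of the change of basis -/
  Sinv : Matrix (Σ i, Fin (size i)) (Fin d) ℂ
  size_pos : ∀ i, 0 < size i
  mul_inv : S * Sinv = 1
  inv_mul : Sinv * S = 1
  conj_eq : Sinv * M * S = Matrix.blockDiagonal' fun i => jordanBlock (eigenvalue i) (size i)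

/-- The largest size of a Jordan block of `A` whose eigenvalue has the smallest real part. -/
def maxBlockSize {d : ℕ} (A : Matrix (Fin d) (Fin d) ℝ) : ℕ :=
  sSup {k | ∃ (D : JordanForm (toComplex A)) (i : Fin D.numBlocks),
    (D.eigenvalue i).re = minRealPart A ∧ D.size i = k}

/-- `C` is a positive constant with `‖e^{-t A_J H}‖ ≤ C (1 + t^{n₁-1}) e^{-t λ₁^J}` for all
`t ≥ 0`, in the spectral norm. -/
def IsDecayConstant {d : ℕ} (H J : Matrix (Fin d) (Fin d) ℝ) (C : ℝ) : Prop :=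
  0 < C ∧ ∀ t : ℝ, 0 ≤ t →
    ‖act (NormedSpace.exp ((-t) • driftMatrix H J))‖ ≤
      C * (1 + t ^ (maxBlockSize (driftMatrix H J) - 1)) *
        Real.exp (-t * minRealPart (driftMatrix H J))

/-- The Gibbs measure `π(dx) ∝ exp(-β F(x)) dx`. -/
def gibbs {d : ℕ} (β : ℝ) (F : EuclideanSpace ℝ (Fin d) → ℝ) :
    Measure (EuclideanSpace ℝ (Fin d)) :=
  (volume : Measure (EuclideanSpace ℝ (Fin d))).tilted fun x => -β * F x

/-- The 2-Wasserstein distance: the infimum of `(E ‖Y₁ - Y₂‖²)^{1/2}` over all joint laws `γ` of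
`(Y₁, Y₂)` with marginals `ν₁` and `ν₂`. -/
def W2 {d : ℕ} (ν₁ ν₂ : Measure (EuclideanSpace ℝ (Fin d))) : ℝ≥0∞ :=
  ⨅ (γ : Measure (EuclideanSpace ℝ (Fin d) × EuclideanSpace ℝ (Fin d)))
    (_ : γ.map Prod.fst = ν₁ ∧ γ.map Prod.snd = ν₂),
    (∫⁻ p, ‖p.1 - p.2‖ₑ ^ 2 ∂γ) ^ (1 / 2 : ℝ)

/-- A standard `d`-dimensional Brownian motion: its coordinates are independent standard real
Brownian motions. -/
structure IsStandardBrownian {Ω : Type*} [MeasurableSpace Ω] {d : ℕ}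
    (B : ℝ≥0 → Ω → EuclideanSpace ℝ (Fin d)) (P : Measure Ω) : Prop where
  coord : ∀ i, IsBrownianReal (fun t ω => B t ω i) P
  indep : iIndepFun (fun (i : Fin d) (ω : Ω) (t : ℝ≥0) => B t ω i) P

/-- `X` solves `dX(t) = -A_J ∇F(X(t)) dt + √(2/β) dB_t`, `X(0) = x₀`, `A_J = I + J`: it is a
process with almost surely continuous paths that satisfies the integrated equation. The noise is
additive, so its integral is `√(2/β) B_t`. -/
structure IsNonReversibleLangevin {Ω : Type*} [MeasurableSpace Ω] {d : ℕ}
    (J : Matrix (Fin d) (Fin d) ℝ) (F : EuclideanSpace ℝ (Fin d) → ℝ) (β : ℝ)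
    (x₀ : EuclideanSpace ℝ (Fin d)) (B X : ℝ≥0 → Ω → EuclideanSpace ℝ (Fin d))
    (P : Measure Ω) : Prop where
  aemeasurable : ∀ t, AEMeasurable (X t) P
  continuous : ∀ᵐ ω ∂P, Continuous fun t => X t ω
  equation : ∀ᵐ ω ∂P, ∀ t : ℝ≥0,
    X t ω = x₀ - (∫ s in (0 : ℝ)..t, act (1 + J) (gradient F (X s.toNNReal ω)))
      + √(2 / β) • B t ω

end

end NonReversibleLangevin

namespace NonReversibleLangevin

noncomputable section

/-! ### Jordan bases over an algebraically closed field -/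

section JordanBasis

open Polynomial Module

variable {K : Type*} [Field K]

/-! Write `T` for the drift matrix `(1 + J) * H`, `R = exp(-tT)` and `x* = H⁻¹ b`.

Decay: in a Jordan basis the entries of `exp(-tT)` are combinations of `t ^ m * exp(-tμ)`, with `m`
below the size of a block of eigenvalue `μ`. A block whose real part is not minimal loses to the
exponential gap; a minimal one has `m ≤ n₁ - 1`.

Distance: since `∇F(x) = H (x - x*)`, the equation is linear with additive noise. Testing it against
the adjoint flow `g(s) = exp((s - t) T†) ξ` cancels the drift and leaves weighted sums of Brownian
increments, so no stochastic integral is needed. Their characteristic functions converge to a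
Gaussian one with variance `(2/β) ∫ ‖g‖²`. As `T H⁻¹ = 1 + J` has symmetric part `1`, the integral
is explicit: `X t` has mean `x* + R (x₀ - x*)` and covariance `β⁻¹ (H⁻¹ - R H⁻¹ R†)`.

The Gibbs measure is the Gaussian with mean `x*` and covariance `β⁻¹ H⁻¹`. Hence for `y` Gibbs and
independent of `X t`, the vector `X t + R (y - x₀)` is again Gibbs (`map_prod_eq_gibbs`). This
coupling costs `R (x₀ - y)` (`W2_le_of_map_prod`); the decay bound controls `‖R‖`, and Gaussian
moments control `x₀ - y`. -/

theorem linearIndependent_mk_X_sub_C_pow (a : K) (e : ℕ) :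
    LinearIndependent K fun j : Fin e =>
      Ideal.Quotient.mk (Ideal.span {(X - C a) ^ e}) ((X - C a) ^ (j : ℕ)) := by
  rw [Fintype.linearIndependent_iff]
  intro c hc
  have hsum : ∑ j : Fin e, c j • Ideal.Quotient.mk (Ideal.span {(X - C a) ^ e})
      ((X - C a) ^ (j : ℕ)) = Ideal.Quotient.mk (Ideal.span {(X - C a) ^ e})
        ((∑ j : Fin e, C (c j) * X ^ (j : ℕ)).comp (X - C a)) := by
    simp only [Polynomial.sum_comp, map_sum, mul_comp, C_comp, pow_comp, X_comp]
    refine Finset.sum_congr rfl fun j _ => ?_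
    rw [← smul_eq_C_mul]
    rfl
  rw [hsum, Ideal.Quotient.eq_zero_iff_mem, Ideal.mem_span_singleton] at hc
  set q : K[X] := ∑ j : Fin e, C (c j) * X ^ (j : ℕ) with hq
  -- Substituting `X + C a` for `X` moves the root to the origin, where divisibility is a statement
  -- about low coefficients.
  have hdvd : X ^ e ∣ q := by
    obtain ⟨r, hr⟩ := hc
    refine ⟨r.comp (X + C a), ?_⟩
    have := congrArg (fun s : K[X] => s.comp (X + C a)) hr
    simpa [comp_assoc] using this
  intro j
  have hcoeff : q.coeff j = c j := by
    simp [hq, coeff_C_mul, coeff_X_pow, Fin.val_inj]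
  rw [← hcoeff]
  exact X_pow_dvd_iff.1 hdvd j j.2

/-- The powers of `X - a`, in decreasing order, form a basis of `K[X] / (X - a)^e`. -/
theorem exists_basis_quotient_X_sub_C_pow (a : K) (e : ℕ) {I : Ideal K[X]}
    (hI : I = Ideal.span {(X - C a) ^ e}) :
    ∃ b : Basis (Fin e) K (K[X] ⧸ I),
      ∀ j, b j = Ideal.Quotient.mk I ((X - C a) ^ (e - (j + 1 : ℕ))) := by
  subst hI
  rcases Nat.eq_zero_or_pos e with rfl | he
  · have : Subsingleton (K[X] ⧸ Ideal.span {(X - C a) ^ 0}) := by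
      rw [Ideal.Quotient.subsingleton_iff]
      simp
    exact ⟨Basis.empty _, fun j => j.elim0⟩
  · have : Nonempty (Fin e) := ⟨⟨0, he⟩⟩
    have hmonic : ((X - C a) ^ e).Monic := (monic_X_sub_C a).pow e
    have hfin : finrank K (K[X] ⧸ Ideal.span {(X - C a) ^ e}) = e :=
      ((AdjoinRoot.powerBasis' hmonic).finrank).trans (by simp)
    refine ⟨(basisOfLinearIndependentOfCardEqFinrank (linearIndependent_mk_X_sub_C_pow a e)
      (by simp [hfin])).reindex Fin.revPerm, fun j => ?_⟩
    simp [Basis.reindex_apply, Fin.val_rev]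

theorem dfinsupp_basis_apply {ι : Type*} [DecidableEq ι] {M : ι → Type*}
    [∀ i, AddCommGroup (M i)] [∀ i, Module K (M i)] {η : ι → Type*}
    (b : ∀ i, Basis (η i) K (M i)) (i : ι) (j : η i) :
    DFinsupp.basis b ⟨i, j⟩ = DFinsupp.single i (b i j) := by
  classical
  rw [Basis.apply_eq_iff]
  change (sigmaFinsuppLequivDFinsupp K).symm _ = _
  rw [LinearEquiv.symm_apply_eq]
  refine (DFinsupp.mapRange_single (f := fun i => (b i).repr) (hf := fun i => map_zero _)).trans ?_
  rw [Basis.repr_self]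
  exact (sigmaFinsuppEquivDFinsupp_single ⟨i, j⟩ (1 : K)).symm

variable [IsAlgClosed K]

/-- Every endomorphism of a finite-dimensional space over an algebraically closed field has a
Jordan basis. -/
theorem exists_jordan_basis {V : Type*} [AddCommGroup V] [Module K V] [FiniteDimensional K V]
    (f : End K V) :
    ∃ (n : ℕ) (size : Fin n → ℕ) (μ : Fin n → K) (b : Basis (Σ i, Fin (size i)) K V),
      (∀ i, 0 < size i) ∧
      (∀ i (h : 0 < size i), f (b ⟨i, ⟨0, h⟩⟩) = μ i • b ⟨i, ⟨0, h⟩⟩) ∧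
      ∀ i (j : ℕ) (h : j + 1 < size i), f (b ⟨i, ⟨j + 1, h⟩⟩) =
        μ i • b ⟨i, ⟨j + 1, h⟩⟩ + b ⟨i, ⟨j, (Nat.lt_succ_self j).trans h⟩⟩ := by
  classical
  obtain ⟨ι, _, p, hp, e, ⟨φ⟩⟩ := Module.equiv_directSum_of_isTorsion
    (Module.AEval.isTorsion_of_finiteDimensional (K := K) V f)
  have hroot : ∀ i, ∃ a : K, Submodule.span K[X] {p i ^ e i} = Ideal.span {(X - C a) ^ e i} := by
    intro i
    obtain ⟨a, ha⟩ := IsAlgClosed.exists_root (p i)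
      (by rw [IsAlgClosed.degree_eq_one_of_irreducible K (hp i)]; exact one_ne_zero)
    refine ⟨a, ?_⟩
    have hassoc : Associated (X - C a) (p i) :=
      (irreducible_X_sub_C a).associated_of_dvd (hp i) (dvd_iff_isRoot.2 ha)
    exact (Ideal.span_singleton_eq_span_singleton.2 (hassoc.pow_pow (n := e i))).symm
  choose a ha using hroot
  choose b hb using fun i => exists_basis_quotient_X_sub_C_pow (a i) (e i) (ha i)
  let B : Basis (Σ i, Fin (e i)) K V := ((DFinsupp.basis b).map (φ.restrictScalars K).symm).map
    (Module.AEval.of K V f).symm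
  have hB : ∀ i j, B ⟨i, j⟩ = (Module.AEval.of K V f).symm (φ.symm (DirectSum.lof K[X] ι
      (fun i => K[X] ⧸ Submodule.span K[X] {p i ^ e i}) i
      (Ideal.Quotient.mk _ ((X - C (a i)) ^ (e i - (j + 1 : ℕ)))))) := by
    intro i j
    rw [← hb]
    simp only [B, Basis.map_apply, dfinsupp_basis_apply]
    rfl
  -- `X` acts as `a` plus multiplication by `X - a`. The second part gives the preceding basis
  -- vector, or `(X - a) ^ e = 0` when `j = 0`.
  have hBf : ∀ i j, f (B ⟨i, j⟩) = a i • B ⟨i, j⟩ +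
      (Module.AEval.of K V f).symm (φ.symm (DirectSum.lof K[X] ι
      (fun i => K[X] ⧸ Submodule.span K[X] {p i ^ e i}) i
      (Ideal.Quotient.mk _ ((X - C (a i)) ^ (e i - (j : ℕ)))))) := by
    intro i j
    have hX : ∀ v : Module.AEval K V f, f ((Module.AEval.of K V f).symm v) =
        (Module.AEval.of K V f).symm ((X : K[X]) • v) := fun v => by
      rw [Module.AEval.of_symm_X_smul]; rfl
    have hj : e i - (j : ℕ) = (e i - (j + 1 : ℕ)) + 1 := by omega
    have hu : Ideal.Quotient.mk (Submodule.span K[X] {p i ^ e i}) ((X - C (a i)) ^ (e i - (j : ℕ))) =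
        (X : K[X]) • Ideal.Quotient.mk (Submodule.span K[X] {p i ^ e i})
          ((X - C (a i)) ^ (e i - (j + 1 : ℕ))) -
        (C (a i) : K[X]) • Ideal.Quotient.mk (Submodule.span K[X] {p i ^ e i})
          ((X - C (a i)) ^ (e i - (j + 1 : ℕ))) := by
      rw [hj, pow_succ', sub_mul, map_sub]
      rfl
    rw [hu, hB, hX]
    simp only [map_sub, map_smul, Module.AEval.C_smul, add_sub_cancel]
  -- The torsion decomposition may contain trivial summands with `e i = 0`; discarding them makes
  -- all block sizes positive.
  let σ := Fintype.equivFin {i // 0 < e i}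
  let τ : (Σ k, Fin (e (σ.symm k).1)) ≃ Σ i, Fin (e i) :=
    Equiv.ofBijective (fun x => ⟨(σ.symm x.1).1, x.2⟩) (by
      refine ⟨?_, ?_⟩
      · rintro ⟨k, j⟩ ⟨k', j'⟩ h
        obtain ⟨h₁, h₂⟩ := Sigma.mk.inj_iff.1 h
        obtain rfl : k = k' := σ.symm.injective (Subtype.ext h₁)
        exact congrArg _ (eq_of_heq h₂)
      · rintro ⟨i, j⟩
        obtain ⟨k, hk⟩ := σ.symm.surjective ⟨i, j.pos⟩
        obtain rfl : (σ.symm k).1 = i := by rw [hk]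
        exact ⟨⟨k, j⟩, rfl⟩)
  refine ⟨_, fun k => e (σ.symm k).1, fun k => a (σ.symm k).1, B.reindex τ.symm,
    fun k => (σ.symm k).2, fun k h => ?_, fun k j h => ?_⟩
  · simp only [Basis.reindex_apply]
    change f (B ⟨_, _⟩) = _ • B ⟨_, _⟩
    have hzero : Ideal.Quotient.mk (Submodule.span K[X] {p (σ.symm k).1 ^ e (σ.symm k).1})
        ((X - C (a (σ.symm k).1)) ^ (e (σ.symm k).1 - 0)) = 0 := by
      rw [Ideal.Quotient.eq_zero_iff_mem, ha, Nat.sub_zero]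
      exact Ideal.mem_span_singleton_self _
    rw [hBf, hzero, map_zero, map_zero, map_zero, add_zero]
  · simp only [Basis.reindex_apply]
    change f (B ⟨_, _⟩) = _ • B ⟨_, _⟩ + B ⟨_, _⟩
    rw [hBf, hB _ ⟨j, _⟩]

end JordanBasis

/-! ### Exponential decay of the matrix semigroup -/

section Decay

open Filter Asymptotics Set
open scoped Topology Nat

theorem nonempty_jordanForm {d : ℕ} (M : Matrix (Fin d) (Fin d) ℂ) : Nonempty (JordanForm M) := by
  obtain ⟨n, size, μ, b, hpos, h0, h1⟩ := exists_jordan_basis (Matrix.toLin' M)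
  refine ⟨⟨n, size, μ, (Pi.basisFun ℂ (Fin d)).toMatrix b, b.toMatrix (Pi.basisFun ℂ (Fin d)), hpos,
    Module.Basis.toMatrix_mul_toMatrix_flip _ _, Module.Basis.toMatrix_mul_toMatrix_flip _ _, ?_⟩⟩
  have hM : M = LinearMap.toMatrix (Pi.basisFun ℂ (Fin d)) (Pi.basisFun ℂ (Fin d))
      (Matrix.toLin' M) := by
    rw [LinearMap.toMatrix_eq_toMatrix', LinearMap.toMatrix'_toLin']
  nth_rewrite 1 [hM]
  rw [basis_toMatrix_mul_linearMap_toMatrix_mul_basis_toMatrix]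
  ext ⟨i, a⟩ ⟨j, ⟨c, hc⟩⟩
  rw [LinearMap.toMatrix_apply, Matrix.blockDiagonal'_apply]
  rcases c with _ | c
  · rw [h0, map_smul, Module.Basis.repr_self]
    by_cases hij : i = j
    · subst hij
      simp [jordanBlock, Finsupp.single_apply, eq_comm]
    · simp [hij]
  · rw [h1, map_add, map_smul, Module.Basis.repr_self, Module.Basis.repr_self]
    by_cases hij : i = j
    · subst hij
      obtain ⟨a, ha⟩ := a
      simp only [Finsupp.add_apply, Finsupp.smul_apply, Finsupp.single_apply, Sigma.mk.injEq,
        heq_eq_eq, true_and, Fin.mk.injEq, jordanBlock, Matrix.of_apply, dite_true, cast_eq]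
      by_cases h₁ : a = c + 1
      · subst h₁; simp
      · by_cases h₂ : a = c
        · subst h₂; simp
        · simp [h₁, h₂, Ne.symm h₁, Ne.symm h₂]
    · simp [hij]

namespace JordanForm

variable {d : ℕ} {M : Matrix (Fin d) (Fin d) ℂ} (D : JordanForm M)
include D

/-- Makes the set in `maxBlockSize` bounded above; otherwise its `sSup` in `ℕ` would be the default
value `0`. -/
theorem size_le (i : Fin D.numBlocks) : D.size i ≤ d := by
  have h := Matrix.square_of_invertible D.S D.Sinv D.mul_inv D.inv_mul
  rw [Fintype.card_fin, Fintype.card_sigma] at h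
  refine le_of_le_of_eq ?_ h.symm
  simpa using Finset.single_le_sum (f := fun j => Fintype.card (Fin (D.size j)))
    (fun _ _ => Nat.zero_le _) (Finset.mem_univ i)

theorem mul_S : M * D.S = D.S * Matrix.blockDiagonal' fun i =>
    jordanBlock (D.eigenvalue i) (D.size i) := by
  rw [← D.conj_eq, ← Matrix.mul_assoc, ← Matrix.mul_assoc, D.mul_inv, Matrix.one_mul]

/-- The column of `S` at the start of a block is an eigenvector of `M`. -/
theorem eigenvalue_mem_spectrum (i : Fin D.numBlocks) : D.eigenvalue i ∈ spectrum ℂ M := by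
  let c : Σ i, Fin (D.size i) := ⟨i, ⟨0, D.size_pos i⟩⟩
  have hcol : (Matrix.blockDiagonal' fun i => jordanBlock (D.eigenvalue i) (D.size i)).mulVec
      (Pi.single c 1) = D.eigenvalue i • Pi.single c 1 := by
    ext ⟨j, a⟩
    rw [Matrix.mulVec_single_one, Matrix.col_apply, Matrix.blockDiagonal'_apply]
    by_cases hij : j = i
    · subst hij
      simp [jordanBlock, c, Pi.single_apply]
    · simp [hij, c]
  rw [← Matrix.spectrum_toLin', ← Module.End.hasEigenvalue_iff_mem_spectrum]
  refine Module.End.hasEigenvalue_of_hasEigenvector (x := D.S.mulVec (Pi.single c 1))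
    (Module.End.hasEigenvector_iff.2 ⟨Module.End.mem_eigenspace_iff.2 ?_, ?_⟩)
  · rw [Matrix.toLin'_apply, Matrix.mulVec_mulVec, D.mul_S, ← Matrix.mulVec_mulVec, hcol,
      Matrix.mulVec_smul]
  · intro h
    have h' := congrArg D.Sinv.mulVec h
    rw [Matrix.mulVec_mulVec, D.inv_mul, Matrix.one_mulVec, Matrix.mulVec_zero] at h'
    simpa using congrFun h' c

end JordanForm

theorem jordanBlock_eq (μ : ℂ) (k : ℕ) : jordanBlock μ k = μ • 1 + jordanBlock 0 k := by
  ext i j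
  by_cases h : i = j
  · subst h; simp [jordanBlock]
  · simp [jordanBlock, h]

theorem jordanBlock_zero_pow_apply (k m : ℕ) (i j : Fin k) :
    (jordanBlock 0 k ^ m) i j = if (i : ℕ) + m = j then 1 else 0 := by
  induction m generalizing i with
  | zero => simp [Matrix.one_apply, Fin.ext_iff]
  | succ m ih =>
    rw [pow_succ', Matrix.mul_apply]
    simp only [ih]
    simp only [jordanBlock, Matrix.of_apply]
    by_cases h : (i : ℕ) + 1 < k
    · rw [Finset.sum_eq_single ⟨i + 1, h⟩]
      · simp [Fin.ext_iff, add_assoc, add_comm 1 m]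
      · intro l _ hl
        have : ¬ (i : ℕ) + 1 = l := fun h' => hl (Fin.ext h'.symm)
        simp [this]
      · simp
    · rw [Finset.sum_eq_zero, if_neg (by omega)]
      intro l _
      have : ¬ (i : ℕ) + 1 = l := by omega
      simp [this]

/-- The scalar part commutes with the nilpotent part, whose `k`-th power vanishes, so the
exponential series stops. This is the source of the polynomial factor. -/
theorem exp_smul_jordanBlock (μ : ℂ) (k : ℕ) (s : ℂ) :
    NormedSpace.exp (s • jordanBlock μ k) =
      Complex.exp (s * μ) • ∑ m ∈ Finset.range k, ((m ! : ℂ)⁻¹ * s ^ m) • jordanBlock 0 k ^ m := by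
  have hN : jordanBlock 0 k ^ k = 0 := by
    ext i j
    rw [jordanBlock_zero_pow_apply, if_neg (by omega), Matrix.zero_apply]
  have hnil : NormedSpace.exp (s • jordanBlock 0 k) =
      ∑ m ∈ Finset.range k, ((m ! : ℂ)⁻¹ * s ^ m) • jordanBlock 0 k ^ m := by
    rw [NormedSpace.exp_eq_tsum ℂ]
    simp only [smul_pow, smul_smul]
    refine tsum_eq_sum fun m hm => ?_
    rw [pow_eq_zero_of_le (by simpa using hm) hN, smul_zero]
  have hscal : NormedSpace.exp ((s * μ) • (1 : Matrix (Fin k) (Fin k) ℂ)) =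
      Complex.exp (s * μ) • 1 := by
    rw [Matrix.smul_one_eq_diagonal, Matrix.exp_diagonal, Matrix.smul_one_eq_diagonal,
      Complex.exp_eq_exp_ℂ]
    congr 1
    ext i
    simp
  rw [jordanBlock_eq, smul_add, smul_smul, Matrix.exp_add_of_commute, hscal, hnil, smul_mul_assoc,
    one_mul]
  exact ((Commute.one_left _).smul_left _).smul_right _

section Conj

attribute [local instance] Matrix.linftyOpNormedRing Matrix.linftyOpNormedAlgebra
  Matrix.linftyOpNormedAddCommGroup

theorem JordanForm.exp_smul_eq {d : ℕ} {M : Matrix (Fin d) (Fin d) ℂ} (D : JordanForm M) (s : ℂ) :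
    NormedSpace.exp (s • M) = D.S * (Matrix.blockDiagonal' fun i =>
      NormedSpace.exp (s • jordanBlock (D.eigenvalue i) (D.size i))) * D.Sinv := by
  -- Conjugation as a continuous ring homomorphism between matrix rings over two index types; as
  -- such it commutes with `exp`.
  let conj : Matrix (Σ i, Fin (D.size i)) (Σ i, Fin (D.size i)) ℂ →+* Matrix (Fin d) (Fin d) ℂ :=
    { toFun := fun N => D.S * N * D.Sinv
      map_one' := by rw [Matrix.mul_one, D.mul_inv]
      map_mul' := fun N N' => by
        have h : D.Sinv * (D.S * (N' * D.Sinv)) = N' * D.Sinv := by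
          rw [← Matrix.mul_assoc, D.inv_mul, Matrix.one_mul]
        simp only [Matrix.mul_assoc, h]
      map_zero' := by simp
      map_add' := fun N N' => by rw [Matrix.mul_add, Matrix.add_mul] }
  have hc : Continuous conj :=
    (continuous_const.matrix_mul continuous_id).matrix_mul continuous_const
  have hM : s • M = conj (Matrix.blockDiagonal' fun i =>
      s • jordanBlock (D.eigenvalue i) (D.size i)) := by
    change _ = D.S * Matrix.blockDiagonal' (s • fun i =>
      jordanBlock (D.eigenvalue i) (D.size i)) * D.Sinv
    rw [Matrix.blockDiagonal'_smul, Matrix.mul_smul, ← D.mul_S, Matrix.smul_mul, Matrix.mul_assoc,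
      D.mul_inv, Matrix.mul_one]
  rw [hM]
  refine (NormedSpace.map_exp conj hc _).symm.trans ?_
  exact congrArg (fun N => D.S * N * D.Sinv) ((Matrix.exp_blockDiagonal' fun i =>
    s • jordanBlock (D.eigenvalue i) (D.size i)).trans
    (congrArg Matrix.blockDiagonal' (Pi.exp_def _)))

end Conj

/-- The gap `δ = ν - lam` absorbs any power, by `(δ t) ^ m / m! ≤ exp (δ t)`. -/
theorem isBigO_pow_mul_exp_of_lt {lam ν : ℝ} (h : lam < ν) (m n : ℕ) :
    (fun t : ℝ => t ^ m * Real.exp (-t * ν)) =O[𝓟 (Ici 0)]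
      fun t => (1 + t ^ n) * Real.exp (-t * lam) := by
  have hδ : 0 < ν - lam := sub_pos.2 h
  refine isBigO_principal.2 ⟨m ! / (ν - lam) ^ m, fun t ht => ?_⟩
  have ht : 0 ≤ t := ht
  have h₁ : ((ν - lam) * t) ^ m / m ! ≤ Real.exp ((ν - lam) * t) :=
    Real.pow_div_factorial_le_exp _ (by positivity) m
  have h₂ : t ^ m ≤ m ! / (ν - lam) ^ m * Real.exp ((ν - lam) * t) := by
    rw [mul_pow, div_le_iff₀ (by positivity)] at h₁
    rw [div_mul_eq_mul_div, le_div_iff₀ (by positivity)]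
    linarith
  rw [Real.norm_of_nonneg (by positivity), Real.norm_of_nonneg (by positivity)]
  calc t ^ m * Real.exp (-t * ν)
      ≤ m ! / (ν - lam) ^ m * Real.exp ((ν - lam) * t) * Real.exp (-t * ν) := by gcongr
    _ = m ! / (ν - lam) ^ m * (1 * Real.exp (-t * lam)) := by
        rw [mul_assoc, ← Real.exp_add, one_mul]
        congr 2
        ring
    _ ≤ _ := by
        gcongr
        linarith [pow_nonneg ht n]

theorem isBigO_pow_mul_exp_of_le (lam : ℝ) {m n : ℕ} (h : m ≤ n) :
    (fun t : ℝ => t ^ m * Real.exp (-t * lam)) =O[𝓟 (Ici 0)]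
      fun t => (1 + t ^ n) * Real.exp (-t * lam) := by
  refine isBigO_principal.2 ⟨1, fun t ht => ?_⟩
  have ht : 0 ≤ t := ht
  rw [Real.norm_of_nonneg (by positivity), Real.norm_of_nonneg (by positivity), one_mul]
  gcongr
  rcases le_total t 1 with h₁ | h₁
  · linarith [pow_le_one₀ (n := m) ht h₁, pow_nonneg ht n]
  · linarith [pow_le_pow_right₀ h₁ h]

theorem minRealPart_le {d : ℕ} (A : Matrix (Fin d) (Fin d) ℝ) {μ : ℂ}
    (hμ : μ ∈ spectrum ℂ (toComplex A)) : minRealPart A ≤ μ.re :=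
  csInf_le ((Matrix.finite_spectrum _).image _).bddBelow (mem_image_of_mem _ hμ)

theorem size_le_maxBlockSize {d : ℕ} (A : Matrix (Fin d) (Fin d) ℝ) (D : JordanForm (toComplex A))
    (i : Fin D.numBlocks) (hi : (D.eigenvalue i).re = minRealPart A) :
    D.size i ≤ maxBlockSize A :=
  le_csSup ⟨d, by rintro _ ⟨D, i, -, rfl⟩; exact D.size_le i⟩ ⟨D, i, hi, rfl⟩

theorem exp_jordanBlock_isBigO {d : ℕ} (A : Matrix (Fin d) (Fin d) ℝ)
    (D : JordanForm (toComplex A)) (i : Fin D.numBlocks) (a b : Fin (D.size i)) :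
    (fun t : ℝ => NormedSpace.exp ((-t : ℂ) • jordanBlock (D.eigenvalue i) (D.size i)) a b)
      =O[𝓟 (Ici 0)]
      fun t => (1 + t ^ (maxBlockSize A - 1)) * Real.exp (-t * minRealPart A) := by
  simp only [exp_smul_jordanBlock, Matrix.smul_apply, Matrix.sum_apply, smul_eq_mul, Finset.mul_sum]
  apply IsBigO.fun_sum
  intro m hm
  have hm : m < D.size i := Finset.mem_range.1 hm
  have hbase : (fun t : ℝ => t ^ m * Real.exp (-t * (D.eigenvalue i).re)) =O[𝓟 (Ici 0)]
      fun t => (1 + t ^ (maxBlockSize A - 1)) * Real.exp (-t * minRealPart A) := by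
    rcases (minRealPart_le A (D.eigenvalue_mem_spectrum i)).lt_or_eq with h | h
    · exact isBigO_pow_mul_exp_of_lt h _ _
    · rw [← h]
      have := size_le_maxBlockSize A D i h.symm
      exact isBigO_pow_mul_exp_of_le _ (by omega)
  refine IsBigO.trans ?_ hbase
  refine isBigO_principal.2 ⟨‖((m ! : ℂ)⁻¹ * (jordanBlock 0 (D.size i) ^ m) a b)‖, fun t ht => ?_⟩
  have ht : 0 ≤ t := ht
  simp only [norm_mul, norm_pow, norm_neg, Complex.norm_exp, Complex.norm_real, Real.norm_eq_abs,
    Real.abs_exp, abs_of_nonneg ht, Complex.mul_re, Complex.neg_re, Complex.neg_im,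
    Complex.ofReal_re, Complex.ofReal_im]
  simp only [neg_zero, zero_mul, sub_zero]
  apply le_of_eq
  ring

section MapExp

attribute [local instance] Matrix.linftyOpNormedRing Matrix.linftyOpNormedAlgebra
  Matrix.linftyOpNormedAddCommGroup

theorem toComplex_exp {d : ℕ} (A : Matrix (Fin d) (Fin d) ℝ) :
    toComplex (NormedSpace.exp A) = NormedSpace.exp (toComplex A) :=
  NormedSpace.map_exp Complex.ofRealHom.mapMatrix
    (continuous_id.matrix_map Complex.continuous_ofReal) A

theorem act_exp {d : ℕ} (A : Matrix (Fin d) (Fin d) ℝ) :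
    act (NormedSpace.exp A) = NormedSpace.exp (act A) :=
  NormedSpace.map_exp (Matrix.toEuclideanCLM (𝕜 := ℝ) (n := Fin d))
    (LinearMap.continuous_of_finiteDimensional
      (Matrix.toEuclideanCLM (𝕜 := ℝ) (n := Fin d)).toAlgEquiv.toLinearMap) A

end MapExp

theorem exp_apply_isBigO {d : ℕ} (A : Matrix (Fin d) (Fin d) ℝ) (i j : Fin d) :
    (fun t : ℝ => NormedSpace.exp ((-t) • A) i j) =O[𝓟 (Ici 0)]
      fun t => (1 + t ^ (maxBlockSize A - 1)) * Real.exp (-t * minRealPart A) := by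
  obtain ⟨D⟩ := nonempty_jordanForm (toComplex A)
  have hcomplex : (fun t : ℝ => NormedSpace.exp ((-t : ℂ) • toComplex A) i j) =O[𝓟 (Ici 0)]
      fun t => (1 + t ^ (maxBlockSize A - 1)) * Real.exp (-t * minRealPart A) := by
    simp only [D.exp_smul_eq, Matrix.mul_apply, Finset.sum_mul]
    apply IsBigO.fun_sum
    intro x _
    apply IsBigO.fun_sum
    intro y _
    obtain ⟨k, a⟩ := x
    obtain ⟨l, b⟩ := y
    simp only [mul_comm _ (D.Sinv _ _)]
    refine IsBigO.const_mul_left (IsBigO.const_mul_left ?_ _) _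
    simp only [Matrix.blockDiagonal'_apply]
    split_ifs with h
    · subst h
      exact exp_jordanBlock_isBigO A D _ _ _
    · exact isBigO_zero _ _
  refine (IsBigO.of_norm_left ?_)
  refine hcomplex.norm_left.congr_left fun t => ?_
  have h := congrFun (congrFun (toComplex_exp ((-t) • A)) i) j
  have h' : toComplex ((-t) • A) = (-t : ℂ) • toComplex A := by
    ext; simp
  rw [← h', ← h]
  exact Complex.norm_real _

theorem exists_isDecayConstant {d : ℕ} (H J : Matrix (Fin d) (Fin d) ℝ) :
    ∃ C : ℝ, IsDecayConstant H J C := by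
  have h : (fun t : ℝ => act (NormedSpace.exp ((-t) • driftMatrix H J))) =O[𝓟 (Ici 0)]
      fun t => (1 + t ^ (maxBlockSize (driftMatrix H J) - 1)) *
        Real.exp (-t * minRealPart (driftMatrix H J)) := by
    -- Expanding in matrix units turns the entrywise bounds into one for the operator norm.
    have hsum : ∀ N : Matrix (Fin d) (Fin d) ℝ,
        act N = ∑ i, ∑ j, N i j • act (Matrix.single i j 1) := by
      intro N
      conv_lhs => rw [Matrix.matrix_eq_sum_single N]
      simp only [map_sum, ← map_smul, Matrix.smul_single, smul_eq_mul, mul_one]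
    simp only [hsum (NormedSpace.exp _)]
    apply IsBigO.fun_sum
    intro i _
    apply IsBigO.fun_sum
    intro j _
    simpa using (exp_apply_isBigO (driftMatrix H J) i j).smul
      (isBigO_const_const (act (Matrix.single i j (1 : ℝ))) (one_ne_zero (α := ℝ)) (𝓟 (Ici 0)))
  obtain ⟨C, hC, hb⟩ := h.exists_pos
  refine ⟨C, hC, fun t ht => ?_⟩
  have := (isBigOWith_principal.1 hb) t ht
  rwa [Real.norm_of_nonneg (by positivity), ← mul_assoc] at this

end Decay

/-! ### Pathwise integration against the noise -/

section Path

open Filter Set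
open scoped Topology

/-- The point `k t / (n + 1)` of the uniform grid with `n + 1` cells on `[0, t]`. -/
def gridPoint (t : ℝ) (n k : ℕ) : ℝ := k * (t / (n + 1))

theorem gridPoint_zero (t : ℝ) (n : ℕ) : gridPoint t n 0 = 0 := by simp [gridPoint]

theorem gridPoint_last (t : ℝ) (n : ℕ) : gridPoint t n (n + 1) = t := by
  have : (n + 1 : ℝ) ≠ 0 := by positivity
  simp only [gridPoint, Nat.cast_add, Nat.cast_one]
  field_simp

theorem gridPoint_succ_sub (t : ℝ) (n k : ℕ) :
    gridPoint t n (k + 1) - gridPoint t n k = t / (n + 1) := by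
  simp only [gridPoint, Nat.cast_add, Nat.cast_one]
  ring

theorem gridPoint_mono {t : ℝ} (ht : 0 ≤ t) (n : ℕ) : Monotone (gridPoint t n) := by
  intro j k hjk
  simp only [gridPoint]
  gcongr

theorem gridPoint_nonneg {t : ℝ} (ht : 0 ≤ t) (n k : ℕ) : 0 ≤ gridPoint t n k := by
  simp only [gridPoint]
  positivity

theorem gridPoint_mem_Icc {t : ℝ} (ht : 0 ≤ t) {n k : ℕ} (hk : k ≤ n + 1) :
    gridPoint t n k ∈ Icc 0 t :=
  ⟨gridPoint_nonneg ht n k, (gridPoint_mono ht n hk).trans_eq (gridPoint_last t n)⟩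

/-- Riemann sums whose integrands depend on the end points of the cells. -/
theorem tendsto_sum_integral_gridPoint {Φ : ℝ × ℝ × ℝ → ℝ} (hΦ : Continuous Φ) {t : ℝ}
    (ht : 0 ≤ t) :
    Tendsto (fun n : ℕ => ∑ k ∈ Finset.range (n + 1),
        ∫ s in gridPoint t n k..gridPoint t n (k + 1),
          Φ (gridPoint t n k, s, gridPoint t n (k + 1)))
      atTop (𝓝 (∫ s in (0 : ℝ)..t, Φ (s, s, s))) := by
  have hK : IsCompact (Icc 0 t ×ˢ Icc 0 t ×ˢ Icc 0 t) :=
    isCompact_Icc.prod (isCompact_Icc.prod isCompact_Icc)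
  have hunif := Metric.uniformContinuousOn_iff.1
    (hK.uniformContinuousOn_of_continuous hΦ.continuousOn)
  rw [Metric.tendsto_atTop]
  intro ε hε
  -- Dividing by `t + 1` instead of `t` covers `t = 0` and makes the final inequality strict.
  obtain ⟨δ, hδ, hδΦ⟩ := hunif (ε / (t + 1)) (by positivity)
  obtain ⟨N, hN⟩ := exists_nat_gt (t / δ)
  refine ⟨N, fun n hn => ?_⟩
  have hmesh : t / (n + 1) < δ := by
    rw [div_lt_iff₀ (by positivity)]
    rw [div_lt_iff₀ hδ] at hN
    have : (N : ℝ) ≤ n := by exact_mod_cast hn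
    nlinarith
  have hsplit : ∫ s in (0 : ℝ)..t, Φ (s, s, s) = ∑ k ∈ Finset.range (n + 1),
      ∫ s in gridPoint t n k..gridPoint t n (k + 1), Φ (s, s, s) := by
    rw [intervalIntegral.sum_integral_adjacent_intervals, gridPoint_zero, gridPoint_last]
    exact fun k _ => (Continuous.intervalIntegrable (by fun_prop) _ _)
  rw [hsplit, dist_eq_norm, ← Finset.sum_sub_distrib]
  calc ‖∑ k ∈ Finset.range (n + 1), ((∫ s in gridPoint t n k..gridPoint t n (k + 1),
          Φ (gridPoint t n k, s, gridPoint t n (k + 1))) -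
          ∫ s in gridPoint t n k..gridPoint t n (k + 1), Φ (s, s, s))‖
      ≤ ∑ k ∈ Finset.range (n + 1), ε / (t + 1) * (t / (n + 1)) := by
        refine norm_sum_le_of_le _ fun k hk => ?_
        have hk : k < n + 1 := Finset.mem_range.1 hk
        have hle := gridPoint_mono ht n (Nat.le_succ k)
        have h₁ := gridPoint_mem_Icc ht hk.le
        have h₂ := gridPoint_mem_Icc ht (Nat.succ_le_of_lt hk)
        have hsub := gridPoint_succ_sub t n k
        rw [← intervalIntegral.integral_sub (Continuous.intervalIntegrable (by fun_prop) _ _)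
          (Continuous.intervalIntegrable (by fun_prop) _ _)]
        refine (intervalIntegral.norm_integral_le_of_norm_le_const
          (C := ε / (t + 1)) fun s hs => ?_).trans ?_
        · rw [uIoc_of_le hle] at hs
          have hs' : s ∈ Icc 0 t := ⟨h₁.1.trans hs.1.le, hs.2.trans h₂.2⟩
          rw [← dist_eq_norm]
          refine (hδΦ _ ⟨h₁, hs', h₂⟩ _ ⟨hs', hs', hs'⟩ ?_).le
          simp only [Prod.dist_eq, max_lt_iff, Real.dist_eq, abs_lt]
          have := hs.1
          have := hs.2
          refine ⟨⟨?_, ?_⟩, ⟨?_, ?_⟩, ⟨?_, ?_⟩⟩ <;> simp only [Nat.succ_eq_add_one] at * <;> linarith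
        · rw [hsub, abs_of_nonneg (by positivity)]
    _ = ε * (t / (t + 1)) := by
        rw [Finset.sum_const, Finset.card_range, nsmul_eq_mul]
        push_cast
        field_simp
    _ < ε := by
        refine mul_lt_of_lt_one_right hε ?_
        rw [div_lt_one (by positivity)]
        linarith

variable {E : Type*} [NormedAddCommGroup E] [InnerProductSpace ℝ E] [CompleteSpace E]

/-- If `dz = -T z ds + σ dw` and `g' = T† g`, then `⟪g, z⟫` is the pathwise Stieltjes integral
of `g` against `σ dw`. -/
theorem tendsto_sum_inner_increments {T : E →L[ℝ] E} {σ : ℝ} {z w g : ℝ → E} {t : ℝ} (ht : 0 ≤ t)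
    (hz : Continuous z)
    (hzw : ∀ s, 0 ≤ s → z s = z 0 - (∫ r in (0 : ℝ)..s, T (z r)) + σ • w s)
    (hg : ∀ s, HasDerivAt g (T.adjoint (g s)) s) :
    Tendsto (fun n : ℕ => ∑ k ∈ Finset.range (n + 1), inner ℝ (σ • g (gridPoint t n k))
        (w (gridPoint t n (k + 1)) - w (gridPoint t n k)))
      atTop (𝓝 (inner ℝ (g t) (z t) - inner ℝ (g 0) (z 0))) := by
  have hgc : Continuous g := continuous_iff_continuousAt.2 fun s => (hg s).continuousAt
  -- The error of summation by parts on one cell, as a function of left end, running point and right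
  -- end. It vanishes on the diagonal, so the summed errors tend to `0`.
  let Φ : ℝ × ℝ × ℝ → ℝ := fun p =>
    inner ℝ (T.adjoint (g p.1)) (z p.2.1) - inner ℝ (T.adjoint (g p.2.1)) (z p.2.2)
  have hΦ : Continuous Φ := by fun_prop
  have hlim := (tendsto_sum_integral_gridPoint hΦ ht).const_add
    (inner ℝ (g t) (z t) - inner ℝ (g 0) (z 0))
  have hzero : ∫ s in (0 : ℝ)..t, Φ (s, s, s) = 0 := by simp [Φ]
  rw [hzero, add_zero] at hlim
  refine hlim.congr fun n => ?_
  have htel : inner ℝ (g t) (z t) - inner ℝ (g 0) (z 0) = ∑ k ∈ Finset.range (n + 1),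
      (inner ℝ (g (gridPoint t n (k + 1))) (z (gridPoint t n (k + 1))) -
        inner ℝ (g (gridPoint t n k)) (z (gridPoint t n k))) := by
    rw [Finset.sum_range_sub (fun k => inner ℝ (g (gridPoint t n k)) (z (gridPoint t n k))),
      gridPoint_zero, gridPoint_last]
  rw [htel, ← Finset.sum_add_distrib]
  refine Finset.sum_congr rfl fun k _ => ?_
  have ha := gridPoint_nonneg ht n k
  have hb := gridPoint_nonneg ht n (k + 1)
  generalize gridPoint t n k = a at *
  generalize gridPoint t n (k + 1) = b at *
  have hTz : Continuous fun r => T (z r) := by fun_prop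
  have hw : σ • (w b - w a) = z b - z a + ∫ r in a..b, T (z r) := by
    rw [← intervalIntegral.integral_interval_sub_left (hTz.intervalIntegrable 0 b)
      (hTz.intervalIntegrable 0 a), smul_sub, hzw b hb, hzw a ha]
    abel
  have hgab : g b - g a = ∫ s in a..b, T.adjoint (g s) :=
    (intervalIntegral.integral_eq_sub_of_hasDerivAt (fun s _ => hg s)
      (Continuous.intervalIntegrable (by fun_prop) _ _)).symm
  have h₁ : ∫ s in a..b, inner ℝ (T.adjoint (g a)) (z s) = inner ℝ (g a) (∫ r in a..b, T (z r)) := by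
    simp only [ContinuousLinearMap.adjoint_inner_left]
    exact (innerSL ℝ (g a)).intervalIntegral_comp_comm (hTz.intervalIntegrable _ _)
  have h₂ : ∫ s in a..b, inner ℝ (T.adjoint (g s)) (z b) = inner ℝ (g b - g a) (z b) := by
    rw [hgab]
    simp only [real_inner_comm (z b)]
    exact (innerSL ℝ (z b)).intervalIntegral_comp_comm
      (Continuous.intervalIntegrable (by fun_prop) _ _)
  simp only [Φ]
  rw [intervalIntegral.integral_sub (Continuous.intervalIntegrable (by fun_prop) _ _)
    (Continuous.intervalIntegrable (by fun_prop) _ _), h₁, h₂, real_inner_smul_left,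
    ← real_inner_smul_right, hw, inner_add_right, inner_sub_right, inner_sub_left]
  ring

end Path

/-! ### Characteristic functions of weighted Brownian increments -/

section Increments

open Complex

variable {Ω : Type*} [MeasurableSpace Ω] {P : Measure Ω}

theorem charFun_map_sum_increments {B : ℝ≥0 → Ω → ℝ} (hB : IsPreBrownianReal B P)
    {τ : ℕ → ℝ≥0} (hτ : Monotone τ) (n : ℕ) (c : ℕ → ℝ) :
    charFun (P.map fun ω => ∑ k : Fin n, c k * (B (τ (k + 1)) ω - B (τ k) ω)) 1 =
      exp (-(∑ k ∈ Finset.range n, c k ^ 2 * (τ (k + 1) - τ k : ℝ)) / 2 : ℝ) := by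
  have hind := ((hB.hasIndepIncrements.nat hτ).precomp (Fin.val_injective (n := n))).comp
    (fun (k : Fin n) x => c k * x) (fun k => by fun_prop)
  have hmeas : ∀ s, AEMeasurable (B s) P := hB.aemeasurable
  have h := hind.charFun_map_fun_sum_eq_prod
    (fun k : Fin n => ((hmeas _).sub (hmeas _)).const_mul (c k))
  refine (congrFun h 1).trans ?_
  rw [Finset.prod_apply]
  have hterm : ∀ k : Fin n, charFun (P.map ((fun x => c k * x) ∘
      fun ω => B (τ (k + 1)) ω - B (τ k) ω)) 1 =
      exp (-(c k ^ 2 * (τ (k + 1) - τ k : ℝ)) / 2 : ℝ) := by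
    intro k
    rw [show (fun ω => B (τ (k + 1)) ω - B (τ k) ω) = B (τ (k + 1)) - B (τ k) from rfl,
      ← AEMeasurable.map_map_of_aemeasurable (by fun_prop) ((hmeas _).sub (hmeas _)),
      (hB.hasLaw_sub (τ (k + 1)) (τ k)).map_eq, gaussianReal_map_const_mul, charFun_gaussianReal]
    have hdist : dist (τ (k + 1)).1 (τ k).1 = τ (k + 1) - τ k := by
      rw [Real.dist_eq, abs_of_nonneg]
      · rfl
      exact sub_nonneg.2 (NNReal.coe_le_coe.2 (hτ (Nat.le_succ _)))
    congr 1
    push_cast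
    rw [hdist]
    push_cast
    ring
  refine (Finset.prod_congr rfl fun k _ => hterm k).trans ?_
  rw [← Complex.exp_sum, Finset.sum_range, ← ofReal_sum, ← Finset.sum_div, Finset.sum_neg_distrib]

/-- Independence of the coordinates factorises the expectation into one-dimensional ones; the
squares of the coordinates of `c k` then add up to `‖c k‖ ^ 2`. -/
theorem IsStandardBrownian.integral_exp_sum_increments {d : ℕ}
    {B : ℝ≥0 → Ω → EuclideanSpace ℝ (Fin d)} (hB : IsStandardBrownian B P)
    {τ : ℕ → ℝ≥0} (hτ : Monotone τ) (n : ℕ) (c : ℕ → EuclideanSpace ℝ (Fin d)) :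
    ∫ ω, exp ((∑ k ∈ Finset.range n, inner ℝ (c k) (B (τ (k + 1)) ω - B (τ k) ω) : ℝ) * I) ∂P =
      exp (-(∑ k ∈ Finset.range n, ‖c k‖ ^ 2 * (τ (k + 1) - τ k : ℝ)) / 2 : ℝ) := by
  have hmeas : ∀ i s, AEMeasurable (fun ω => B s ω i) P := fun i s =>
    (hB.coord i).toIsPreBrownianReal.aemeasurable s
  have hind := hB.indep.comp
    (fun (i : Fin d) (x : ℝ≥0 → ℝ) => ∑ k : Fin n, c k i * (x (τ (k + 1)) - x (τ k)))
    (fun i => by fun_prop)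
  have hmeas' : ∀ i, AEMeasurable
      (fun ω => ∑ k : Fin n, c k i * (B (τ (k + 1)) ω i - B (τ k) ω i)) P := fun i =>
    Finset.aemeasurable_fun_sum _ fun k _ => ((hmeas i _).sub (hmeas i _)).const_mul _
  have h := congrFun (hind.charFun_map_fun_sum_eq_prod hmeas') 1
  rw [Finset.prod_apply] at h
  have h' := h.trans (Finset.prod_congr rfl fun i _ =>
    charFun_map_sum_increments (hB.coord i).toIsPreBrownianReal hτ n fun k => c k i)
  rw [charFun_apply_real, integral_map] at h'
  · refine Eq.trans (integral_congr_ae (.of_forall fun ω => ?_)) (h'.trans ?_)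
    · simp only [ofReal_one, one_mul]
      congr 3
      rw [Finset.sum_comm, Finset.sum_range]
      refine Finset.sum_congr rfl fun k _ => ?_
      simp [PiLp.inner_apply, mul_comm]
    · rw [← Complex.exp_sum, ← ofReal_sum, ← Finset.sum_div, Finset.sum_neg_distrib,
        Finset.sum_comm]
      simp only [EuclideanSpace.real_norm_sq_eq, Finset.sum_mul]
  · exact Finset.aemeasurable_fun_sum Finset.univ fun i _ => hmeas' i
  · fun_prop

end Increments

/-! ### The quadratic objective -/

section Quadratic

variable {d : ℕ}

theorem act_mul_apply (A A' : Matrix (Fin d) (Fin d) ℝ) (x : EuclideanSpace ℝ (Fin d)) :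
    act (A * A') x = act A (act A' x) := by
  rw [act, map_mul]
  rfl

theorem act_one_apply (x : EuclideanSpace ℝ (Fin d)) :
    act (1 : Matrix (Fin d) (Fin d) ℝ) x = x := by
  rw [act, map_one]
  rfl

theorem adjoint_act (A : Matrix (Fin d) (Fin d) ℝ) : (act A).adjoint = act A.transpose := by
  rw [← ContinuousLinearMap.star_eq_adjoint, act, ← map_star, Matrix.star_eq_conjTranspose,
    Matrix.conjTranspose_eq_transpose_of_trivial]

theorem inner_act_left (A : Matrix (Fin d) (Fin d) ℝ) (x y : EuclideanSpace ℝ (Fin d)) :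
    inner ℝ (act A x) y = inner ℝ x (act A.transpose y) := by
  rw [← adjoint_act, ContinuousLinearMap.adjoint_inner_right]

theorem gradient_quadObjective {H : Matrix (Fin d) (Fin d) ℝ} (hH : H.transpose = H)
    (b : EuclideanSpace ℝ (Fin d)) (c : ℝ) (x : EuclideanSpace ℝ (Fin d)) :
    gradient (quadObjective H b c) x = act H x - b := by
  apply HasGradientAt.gradient
  rw [hasGradientAt_iff_hasFDerivAt]
  have h₁ : HasFDerivAt (fun x => inner ℝ x (act H x)) _ x :=
    (hasFDerivAt_id x).inner ℝ (act H).hasFDerivAt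
  have h₂ : HasFDerivAt (fun x => inner ℝ b x) _ x := (innerSL ℝ b).hasFDerivAt
  refine (((h₁.const_mul (1 / 2)).sub h₂).add_const c).congr_fderiv ?_
  ext v
  have hsymm : inner ℝ x (act H v) = inner ℝ (act H x) v := by rw [inner_act_left, hH]
  simp [fderivInnerCLM_apply, hsymm, real_inner_comm (act H x) v]
  ring

/-- Completing the square in the quadratic objective at its minimizer. -/
theorem quadObjective_add {H : Matrix (Fin d) (Fin d) ℝ} (hH : H.transpose = H)
    {b xs : EuclideanSpace ℝ (Fin d)} (hxs : act H xs = b) (c : ℝ)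
    (v : EuclideanSpace ℝ (Fin d)) :
    quadObjective H b c (xs + v) = quadObjective H b c xs + (1 / 2) * inner ℝ v (act H v) := by
  have hsymm : inner ℝ xs (act H v) = inner ℝ b v := by rw [← hxs, inner_act_left, hH]
  simp only [quadObjective, map_add, inner_add_left, inner_add_right, hsymm, hxs,
    real_inner_comm v b]
  ring

end Quadratic

/-! ### Bounds by the smallest eigenvalue -/

section MinEigenvalue

open scoped MatrixOrder

variable {d : ℕ} {H : Matrix (Fin d) (Fin d) ℝ}

theorem transpose_eq_of_posDef (hH : H.PosDef) : H.transpose = H := by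
  rw [← Matrix.conjTranspose_eq_transpose_of_trivial]
  exact hH.isHermitian

/-- For `0 < d` the spectrum is finite and nonempty, so the infimum is an eigenvalue; for `d = 0` it
would be `sInf ∅ = 0`. -/
theorem minEigenvalue_pos (hd : 0 < d) (hH : H.PosDef) : 0 < minEigenvalue H := by
  have : Nonempty (Fin d) := ⟨⟨0, hd⟩⟩
  have hne : (spectrum ℝ H).Nonempty := by
    rw [hH.isHermitian.spectrum_real_eq_range_eigenvalues]
    exact Set.range_nonempty _
  have hmem := hne.csInf_mem (Matrix.finite_spectrum H)
  rw [hH.isHermitian.spectrum_real_eq_range_eigenvalues] at hmem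
  obtain ⟨i, hi⟩ := hmem
  rw [minEigenvalue, hH.isHermitian.spectrum_real_eq_range_eigenvalues, ← hi]
  exact hH.eigenvalues_pos i

theorem minEigenvalue_mul_norm_sq_le (hH : H.PosDef) (v : EuclideanSpace ℝ (Fin d)) :
    minEigenvalue H * ‖v‖ ^ 2 ≤ inner ℝ v (act H v) := by
  have hle : algebraMap ℝ _ (minEigenvalue H) ≤ H :=
    (algebraMap_le_iff_le_spectrum (r := minEigenvalue H) (a := H)
      hH.isHermitian.isSelfAdjoint).2 fun x hx =>
      csInf_le (Matrix.finite_spectrum H).bddBelow hx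
  have hps := (Matrix.le_iff.1 hle).dotProduct_mulVec_nonneg v.ofLp
  have h : inner ℝ v (act (H - algebraMap ℝ _ (minEigenvalue H)) v) =
      inner ℝ v (act H v) - minEigenvalue H * ‖v‖ ^ 2 := by
    rw [act, act, map_sub, Algebra.algebraMap_eq_smul_one, map_smul, map_one, sub_apply,
      inner_sub_right, smul_apply, real_inner_smul_right,
      one_apply_eq_self, real_inner_self_eq_norm_sq]
  rw [Matrix.inner_toEuclideanCLM] at h
  have hps' : 0 ≤ inner ℝ v (act H v) - minEigenvalue H * ‖v‖ ^ 2 := by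
    rw [← h]
    simpa using hps
  linarith

theorem act_act_inv (hH : H.PosDef) (v : EuclideanSpace ℝ (Fin d)) : act H (act H⁻¹ v) = v := by
  rw [← act_mul_apply, Matrix.mul_nonsing_inv _ ((Matrix.isUnit_iff_isUnit_det _).1 hH.isUnit),
    act_one_apply]

/-- With `u = H⁻¹ v`, coercivity and Cauchy–Schwarz give `m ‖u‖² ≤ ⟪u, v⟫ ≤ ‖u‖ ‖v‖`. -/
theorem norm_act_inv_le (hd : 0 < d) (hH : H.PosDef) (v : EuclideanSpace ℝ (Fin d)) :
    ‖act H⁻¹ v‖ ≤ ‖v‖ / minEigenvalue H := by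
  have hm := minEigenvalue_pos hd hH
  have h := minEigenvalue_mul_norm_sq_le hH (act H⁻¹ v)
  rw [act_act_inv hH] at h
  have h' := h.trans (real_inner_le_norm _ _)
  rw [le_div_iff₀ hm]
  rcases (norm_nonneg (act H⁻¹ v)).eq_or_lt with h0 | h0
  · rw [← h0, zero_mul]
    exact norm_nonneg _
  · nlinarith

theorem inner_act_inv_le (hd : 0 < d) (hH : H.PosDef) (v : EuclideanSpace ℝ (Fin d)) :
    inner ℝ v (act H⁻¹ v) ≤ ‖v‖ ^ 2 / minEigenvalue H := by
  refine (real_inner_le_norm _ _).trans ?_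
  rw [pow_two, mul_div_assoc]
  gcongr
  exact norm_act_inv_le hd hH v

end MinEigenvalue

/-! ### The adjoint flow and the Lyapunov identity -/

section Flow

variable {E : Type*} [NormedAddCommGroup E] [InnerProductSpace ℝ E] [CompleteSpace E]

theorem hasDerivAt_exp_sub_smul_apply (T : E →L[ℝ] E) (t : ℝ) (ξ : E) (s : ℝ) :
    HasDerivAt (fun s : ℝ => NormedSpace.exp ((s - t) • T) ξ)
      (T (NormedSpace.exp ((s - t) • T) ξ)) s := by
  have h := (hasDerivAt_exp_smul_const' (𝕂 := ℝ) T (s - t)).scomp s ((hasDerivAt_id s).sub_const t)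
  have h' := h.clm_apply (hasDerivAt_const s ξ)
  simpa using h'

/-- The stationary covariance `Q` of `dz = -T z ds + √2 dw` absorbs the covariance of the noise. -/
theorem two_mul_integral_norm_sq {T Q : E →L[ℝ] E}
    (hQ : ∀ x y, inner ℝ (Q x) y = inner ℝ x (Q y))
    (hTQ : ∀ x, inner ℝ x (T (Q x)) = ‖x‖ ^ 2) {g : ℝ → E}
    (hg : ∀ s, HasDerivAt g (T.adjoint (g s)) s) (a b : ℝ) :
    2 * ∫ s in a..b, ‖g s‖ ^ 2 = inner ℝ (g b) (Q (g b)) - inner ℝ (g a) (Q (g a)) := by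
  have hgc : Continuous g := continuous_iff_continuousAt.2 fun s => (hg s).continuousAt
  rw [← intervalIntegral.integral_const_mul]
  refine intervalIntegral.integral_eq_sub_of_hasDerivAt
    (f := fun s => inner ℝ (g s) (Q (g s))) (fun s _ => ?_)
    (Continuous.intervalIntegrable (by fun_prop) _ _)
  have h := (hg s).inner ℝ (Q.hasFDerivAt.comp_hasDerivAt s (hg s))
  refine h.congr_deriv ?_
  -- The quadratic form of the Lyapunov equation `T Q + Q T† = 2`: each half of the derivative
  -- contributes `‖g s‖ ^ 2`.
  have h₁ : inner ℝ (T.adjoint (g s)) (Q (g s)) = ‖g s‖ ^ 2 := by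
    rw [ContinuousLinearMap.adjoint_inner_left, hTQ]
  have h₂ : inner ℝ (g s) (Q (T.adjoint (g s))) = ‖g s‖ ^ 2 := by
    rw [← hQ, real_inner_comm, h₁]
  simp only [Function.comp_apply, h₁, h₂]
  ring

end Flow

/-! ### The Gaussian law of the solution -/

section Law

open Complex Filter
open scoped Topology

variable {Ω : Type*} [MeasurableSpace Ω] {P : Measure Ω} {d : ℕ}

theorem IsStandardBrownian.aemeasurable {B : ℝ≥0 → Ω → EuclideanSpace ℝ (Fin d)}
    (hB : IsStandardBrownian B P) (s : ℝ≥0) : AEMeasurable (B s) P :=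
  (WithLp.measurable_toLp 2 (Fin d → ℝ)).comp_aemeasurable (aemeasurable_pi_lambda
    (fun ω i => B s ω i) fun i => (hB.coord i).toIsPreBrownianReal.aemeasurable s)

theorem IsStandardBrownian.eval_zero_ae_eq_zero {B : ℝ≥0 → Ω → EuclideanSpace ℝ (Fin d)}
    (hB : IsStandardBrownian B P) : ∀ᵐ ω ∂P, B 0 ω = 0 := by
  have h : ∀ᵐ ω ∂P, ∀ i, B 0 ω i = 0 :=
    ae_all_iff.2 fun i => (hB.coord i).toIsPreBrownianReal.eval_zero_ae_eq_zero
  filter_upwards [h] with ω hω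
  ext i
  exact hω i

/-- `T H⁻¹ = 1 + J`, and a skew matrix has zero quadratic form. This is why `J` does not change the
stationary covariance. -/
theorem inner_act_driftMatrix_act_inv {H J : Matrix (Fin d) (Fin d) ℝ} (hH : H.PosDef)
    (hJ : J.transpose = -J) (x : EuclideanSpace ℝ (Fin d)) :
    inner ℝ x (act (driftMatrix H J) (act H⁻¹ x)) = ‖x‖ ^ 2 := by
  have hskew : inner ℝ x (act J x) = 0 := by
    have h : inner ℝ (act J x) x = -inner ℝ x (act J x) := by
      rw [inner_act_left, hJ, act, map_neg, neg_apply, inner_neg_right]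
    rw [real_inner_comm] at h
    linarith
  rw [driftMatrix, act_mul_apply, act_act_inv hH, act, map_add, map_one, add_apply,
    one_apply_eq_self, inner_add_right, hskew, real_inner_self_eq_norm_sq, add_zero]

theorem inner_act_inv_comm {H : Matrix (Fin d) (Fin d) ℝ} (hH : H.PosDef)
    (x y : EuclideanSpace ℝ (Fin d)) :
    inner ℝ (act H⁻¹ x) y = inner ℝ x (act H⁻¹ y) := by
  rw [inner_act_left, Matrix.transpose_nonsing_inv, transpose_eq_of_posDef hH]

variable {H J : Matrix (Fin d) (Fin d) ℝ} {b x₀ : EuclideanSpace ℝ (Fin d)} {c β : ℝ}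
  {B X : ℝ≥0 → Ω → EuclideanSpace ℝ (Fin d)}

/-- Almost surely, the fluctuation of a linear observable of the solution is a limit of weighted
sums of Brownian increments. -/
theorem IsNonReversibleLangevin.tendsto_sum_increments (hH : H.PosDef)
    (hB : IsStandardBrownian B P)
    (hX : IsNonReversibleLangevin J (quadObjective H b c) β x₀ B X P) (t : ℝ≥0)
    {g : ℝ → EuclideanSpace ℝ (Fin d)}
    (hg : ∀ s, HasDerivAt g ((act (driftMatrix H J)).adjoint (g s)) s) :
    ∀ᵐ ω ∂P, Tendsto (fun n : ℕ => ∑ k ∈ Finset.range (n + 1),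
        inner ℝ (√(2 / β) • g (gridPoint t n k))
          (B (gridPoint t n (k + 1)).toNNReal ω - B (gridPoint t n k).toNNReal ω)) atTop
      (𝓝 (inner ℝ (g t) (X t ω - act H⁻¹ b) - inner ℝ (g 0) (x₀ - act H⁻¹ b))) := by
  filter_upwards [hX.continuous, hX.equation, hB.eval_zero_ae_eq_zero] with ω hcont heq h0
  have hX0 : X 0 ω = x₀ := by
    have := heq 0
    simpa [h0] using this
  -- Centring at the minimizer `H⁻¹ b` makes the drift linear.
  have hdrift : ∀ x, act (1 + J) (gradient (quadObjective H b c) x) =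
      act (driftMatrix H J) (x - act H⁻¹ b) := by
    intro x
    rw [gradient_quadObjective (transpose_eq_of_posDef hH), driftMatrix, act_mul_apply,
      map_sub (act H), act_act_inv hH]
  simp only [hdrift] at heq
  have h := tendsto_sum_inner_increments (T := act (driftMatrix H J)) (σ := √(2 / β))
    (z := fun s => X s.toNNReal ω - act H⁻¹ b) (w := fun s => B s.toNNReal ω) (g := g)
    t.coe_nonneg ((hcont.comp continuous_real_toNNReal).sub continuous_const)
    (fun s hs => by
      have := heq s.toNNReal
      rw [Real.coe_toNNReal s hs] at this
      rw [this, Real.toNNReal_zero, hX0]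
      abel) hg
  simpa only [Real.toNNReal_coe, Real.toNNReal_zero, hX0] using h

/-- The expectations of the approximating sums have two limits: by dominated convergence, that of
the observable; by the Gaussian formula, a Riemann integral of `‖g‖²`, which the Lyapunov identity
evaluates. -/
theorem IsNonReversibleLangevin.charFun_map [IsProbabilityMeasure P] (hH : H.PosDef)
    (hJ : J.transpose = -J) (hβ : 0 < β) (hB : IsStandardBrownian B P)
    (hX : IsNonReversibleLangevin J (quadObjective H b c) β x₀ B X P) (t : ℝ≥0)
    (ξ : EuclideanSpace ℝ (Fin d)) {η : EuclideanSpace ℝ (Fin d)}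
    (hη : η = (act (NormedSpace.exp ((-(t : ℝ)) • driftMatrix H J))).adjoint ξ) :
    charFun (P.map (X t)) ξ =
      exp ((inner ℝ ξ (act H⁻¹ b) + inner ℝ η (x₀ - act H⁻¹ b) : ℝ) * I +
        (-(inner ℝ ξ (act H⁻¹ ξ) - inner ℝ η (act H⁻¹ η)) / (2 * β) : ℝ)) := by
  let T := act (driftMatrix H J)
  let g : ℝ → EuclideanSpace ℝ (Fin d) := fun s => NormedSpace.exp ((s - t) • T.adjoint) ξ
  have hg : ∀ s, HasDerivAt g (T.adjoint (g s)) s :=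
    hasDerivAt_exp_sub_smul_apply T.adjoint t ξ
  have hgt : g t = ξ := by simp [g]
  have hg0 : g 0 = η := by
    rw [hη, act_exp, ← ContinuousLinearMap.star_eq_adjoint, NormedSpace.star_exp, act, map_smul,
      star_smul, ContinuousLinearMap.star_eq_adjoint]
    simp [g, T]
  have hgc : Continuous g := continuous_iff_continuousAt.2 fun s => (hg s).continuousAt
  let S : ℕ → Ω → ℝ := fun n ω => ∑ k ∈ Finset.range (n + 1),
    inner ℝ (√(2 / β) • g (gridPoint t n k))
      (B (gridPoint t n (k + 1)).toNNReal ω - B (gridPoint t n k).toNNReal ω)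
  have hlim := hX.tendsto_sum_increments hH hB t hg
  have hmono : ∀ n, Monotone fun k => (gridPoint t n k).toNNReal := fun n j k hjk =>
    Real.toNNReal_mono (gridPoint_mono t.coe_nonneg n hjk)
  have hint : ∀ n, ∫ ω, exp ((S n ω : ℝ) * I) ∂P =
      exp (-(∑ k ∈ Finset.range (n + 1), ∫ s in gridPoint t n k..gridPoint t n (k + 1),
        ‖g (gridPoint t n k)‖ ^ 2) / β : ℝ) := by
    intro n
    rw [hB.integral_exp_sum_increments (hmono n) (n + 1)
      fun k => √(2 / β) • g (gridPoint t n k)]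
    congr 2
    rw [neg_div, neg_div, Finset.sum_div, Finset.sum_div]
    congr 1
    refine Finset.sum_congr rfl fun k _ => ?_
    rw [Real.coe_toNNReal _ (gridPoint_nonneg t.coe_nonneg _ _),
      Real.coe_toNNReal _ (gridPoint_nonneg t.coe_nonneg _ _), intervalIntegral.integral_const,
      norm_smul, mul_pow, Real.norm_eq_abs, sq_abs, Real.sq_sqrt (by positivity), smul_eq_mul]
    field_simp
  have hlim₁ : Tendsto (fun n => ∫ ω, exp ((S n ω : ℝ) * I) ∂P) atTop
      (𝓝 (∫ ω, exp ((inner ℝ ξ (X t ω - act H⁻¹ b) - inner ℝ η (x₀ - act H⁻¹ b) : ℝ) * I) ∂P)) := by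
    refine tendsto_integral_of_dominated_convergence (fun _ => 1) (fun n => ?_)
      (integrable_const 1) (fun n => .of_forall fun ω => ?_) ?_
    · refine AEMeasurable.aestronglyMeasurable ?_
      have : AEMeasurable (S n) P := Finset.aemeasurable_fun_sum _ fun k _ =>
        ((hB.aemeasurable _).sub (hB.aemeasurable _)).const_inner
      fun_prop
    · rw [norm_exp_ofReal_mul_I]
    · filter_upwards [hlim] with ω hω
      rw [hgt, hg0] at hω
      exact ((continuous_ofReal.tendsto _).comp hω |>.mul_const I).cexp
  have hlim₂ : Tendsto (fun n => ∫ ω, exp ((S n ω : ℝ) * I) ∂P) atTop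
      (𝓝 (exp (-(∫ s in (0 : ℝ)..t, ‖g s‖ ^ 2) / β : ℝ))) := by
    simp only [hint]
    have h := tendsto_sum_integral_gridPoint (Φ := fun p => ‖g p.1‖ ^ 2) (by fun_prop) t.coe_nonneg
    exact ((continuous_ofReal.tendsto _).comp (h.neg.div_const β)).cexp
  have heq := tendsto_nhds_unique hlim₁ hlim₂
  have hcov := two_mul_integral_norm_sq (inner_act_inv_comm hH)
    (inner_act_driftMatrix_act_inv hH hJ) hg 0 t
  rw [hgt, hg0] at hcov
  have hcov' : -(∫ s in (0 : ℝ)..t, ‖g s‖ ^ 2) / β =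
      -(inner ℝ ξ (act H⁻¹ ξ) - inner ℝ η (act H⁻¹ η)) / (2 * β) := by
    rw [← hcov]
    field_simp
  rw [hcov'] at heq
  rw [charFun_apply, integral_map (hX.aemeasurable t) (by fun_prop), exp_add, ← heq,
    ← integral_const_mul]
  refine integral_congr_ae (.of_forall fun ω => ?_)
  simp only [← exp_add]
  congr 1
  rw [inner_sub_right ξ, real_inner_comm]
  push_cast
  ring

end Law

/-! ### The Gibbs measure of a quadratic objective -/

section Gibbs

open Complex
open scoped MatrixOrder

variable {d : ℕ}

theorem exists_symm_mul_self_eq {A : Matrix (Fin d) (Fin d) ℝ} (hA : A.PosDef) :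
    ∃ M : Matrix (Fin d) (Fin d) ℝ, M.transpose = M ∧ M * M = A := by
  refine ⟨CFC.sqrt A, ?_, CFC.sqrt_mul_sqrt_self _ hA.posSemidef.nonneg⟩
  rw [← Matrix.conjTranspose_eq_transpose_of_trivial]
  exact (CFC.sqrt_nonneg A).isSelfAdjoint

theorem det_act_ne_zero {L : Matrix (Fin d) (Fin d) ℝ} (hL : IsUnit L) :
    LinearMap.det (act L).toLinearMap ≠ 0 :=
  (((hL.map (Matrix.toEuclideanCLM (𝕜 := ℝ) (n := Fin d))).map
    ContinuousLinearMap.toLinearMapRingHom).map LinearMap.det).ne_zero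

theorem integral_comp_add_act {F : Type*} [NormedAddCommGroup F] [NormedSpace ℝ F]
    {L : Matrix (Fin d) (Fin d) ℝ} (hL : IsUnit L) (a : EuclideanSpace ℝ (Fin d))
    (f : EuclideanSpace ℝ (Fin d) → F) :
    ∫ u, f (a + act L u) = |(LinearMap.det (act L).toLinearMap)⁻¹| • ∫ x, f x := by
  have hinj : Function.Injective (act L) := by
    refine Function.LeftInverse.injective (g := act L⁻¹) fun u => ?_
    rw [← act_mul_apply, Matrix.nonsing_inv_mul _ ((Matrix.isUnit_iff_isUnit_det _).1 hL),
      act_one_apply]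
  have hemb : MeasurableEmbedding (act L) := (act L).continuous.measurableEmbedding hinj
  have hmap : (volume : Measure (EuclideanSpace ℝ (Fin d))).map (act L) =
      ENNReal.ofReal |(LinearMap.det (act L).toLinearMap)⁻¹| • volume :=
    Measure.map_linearMap_addHaar_eq_smul_addHaar volume (det_act_ne_zero hL)
  rw [← hemb.integral_map (fun v => f (a + v)), hmap, integral_smul_measure,
    ENNReal.toReal_ofReal (abs_nonneg _), integral_add_left_eq_self f a]

/-- Substituting `x = H⁻¹ b + L u` with `L = (β H)^(-1/2)` gives a standard Gaussian integral. The
Jacobian and the constant `K` appear in numerator and normalisation alike and cancel. -/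
theorem charFun_gibbs_quadObjective {H : Matrix (Fin d) (Fin d) ℝ} (hH : H.PosDef)
    (b : EuclideanSpace ℝ (Fin d)) (c : ℝ) {β : ℝ} (hβ : 0 < β) (ξ : EuclideanSpace ℝ (Fin d)) :
    charFun (gibbs β (quadObjective H b c)) ξ =
      exp ((inner ℝ ξ (act H⁻¹ b) : ℝ) * I + (-inner ℝ ξ (act H⁻¹ ξ) / (2 * β) : ℝ)) := by
  obtain ⟨M, hMs, hMM⟩ := exists_symm_mul_self_eq (hH.smul hβ)
  have hMu : IsUnit M := by
    have := (hH.smul hβ).isUnit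
    rw [← hMM] at this
    exact isUnit_of_mul_isUnit_left this
  have hMdet := (Matrix.isUnit_iff_isUnit_det _).1 hMu
  set L := M⁻¹ with hL
  have hLu : IsUnit L := (Matrix.isUnit_nonsing_inv_iff).2 hMu
  have hLs : L.transpose = L := by rw [hL, Matrix.transpose_nonsing_inv, hMs]
  have hLL : L * L = β⁻¹ • H⁻¹ := by
    rw [hL, ← Matrix.mul_inv_rev, hMM]
    refine Matrix.inv_eq_right_inv ?_
    rw [Matrix.smul_mul, Matrix.mul_smul, smul_smul, mul_inv_cancel₀ hβ.ne', one_smul,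
      Matrix.mul_nonsing_inv _ ((Matrix.isUnit_iff_isUnit_det _).1 hH.isUnit)]
  have hnorm : ∀ u, β * inner ℝ (act L u) (act H (act L u)) = ‖u‖ ^ 2 := by
    intro u
    rw [← real_inner_smul_right, ← smul_apply, ← map_smul, ← hMM, act_mul_apply,
      ← act_mul_apply M L, hL, Matrix.mul_nonsing_inv _ hMdet, act_one_apply, ← hL, inner_act_left,
      hLs, ← act_mul_apply, hL, Matrix.nonsing_inv_mul _ hMdet, act_one_apply,
      real_inner_self_eq_norm_sq]
  have hexp : ∀ u, -β * quadObjective H b c (act H⁻¹ b + act L u) =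
      -β * quadObjective H b c (act H⁻¹ b) + -(1 / 2) * ‖u‖ ^ 2 := by
    intro u
    rw [quadObjective_add (transpose_eq_of_posDef hH) (act_act_inv hH b), ← hnorm]
    ring
  have hLξ : ‖act L ξ‖ ^ 2 = inner ℝ ξ (act H⁻¹ ξ) / β := by
    rw [← real_inner_self_eq_norm_sq, inner_act_left, hLs, ← act_mul_apply, hLL, act, map_smul,
      smul_apply, real_inner_smul_right, div_eq_inv_mul]
  have hdet : |(LinearMap.det (act L).toLinearMap)⁻¹| ≠ 0 :=
    abs_ne_zero.2 (inv_ne_zero (det_act_ne_zero hLu))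
  have hgauss : ∀ ζ : EuclideanSpace ℝ (Fin d), ∫ u : EuclideanSpace ℝ (Fin d),
      exp ((-(1 / 2) * ‖u‖ ^ 2 : ℝ) + (inner ℝ ζ u : ℝ) * I) =
        (2 * Real.pi : ℂ) ^ (d / 2 : ℂ) * exp (-‖ζ‖ ^ 2 / 2 : ℝ) := by
    intro ζ
    have h := GaussianFourier.integral_cexp_neg_mul_sq_norm_add (V := EuclideanSpace ℝ (Fin d))
      (b := 1 / 2) (by norm_num) I ζ
    rw [finrank_euclideanSpace_fin] at h
    convert h using 2
    · ext u
      push_cast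
      ring_nf
    · congr 1
      ring
    · push_cast
      rw [I_sq]
      ring_nf
  let K := Real.exp (-β * quadObjective H b c (act H⁻¹ b))
  have hden : |(LinearMap.det (act L).toLinearMap)⁻¹| *
      ∫ x, Real.exp (-β * quadObjective H b c x) =
        K * ∫ u : EuclideanSpace ℝ (Fin d), Real.exp (-(1 / 2) * ‖u‖ ^ 2) := by
    rw [← smul_eq_mul, ← integral_comp_add_act hLu (act H⁻¹ b), ← integral_const_mul]
    simp only [hexp, Real.exp_add, K]
  have hnum : |(LinearMap.det (act L).toLinearMap)⁻¹| •
      ∫ x, Real.exp (-β * quadObjective H b c x) • exp ((inner ℝ x ξ : ℝ) * I) =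
        K • (exp ((inner ℝ ξ (act H⁻¹ b) : ℝ) * I) * ∫ u : EuclideanSpace ℝ (Fin d),
          exp ((-(1 / 2) * ‖u‖ ^ 2 : ℝ) + (inner ℝ (act L ξ) u : ℝ) * I)) := by
    rw [← integral_comp_add_act hLu (act H⁻¹ b), ← integral_const_mul, ← integral_smul]
    refine integral_congr_ae (.of_forall fun u => ?_)
    have hu : inner ℝ (act L u) ξ = inner ℝ (act L ξ) u := by
      rw [inner_act_left, hLs, real_inner_comm]
    simp only [hexp, Real.exp_add, K, inner_add_left, real_smul, exp_add, hu,
      real_inner_comm ξ (act H⁻¹ b)]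
    push_cast
    rw [add_mul, exp_add]
    ring
  have hG0 : ((∫ u : EuclideanSpace ℝ (Fin d), Real.exp (-(1 / 2) * ‖u‖ ^ 2) : ℝ) : ℂ) =
      (2 * Real.pi : ℂ) ^ (d / 2 : ℂ) := by
    have h := hgauss 0
    rw [← integral_complex_ofReal]
    simpa using h
  have hG0ne : (2 * Real.pi : ℂ) ^ (d / 2 : ℂ) ≠ 0 := by
    rw [Ne, cpow_eq_zero_iff]
    have : (2 * Real.pi : ℂ) ≠ 0 := by exact_mod_cast Real.two_pi_pos.ne'
    exact fun h => this h.1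
  have hden' := congrArg (fun r : ℝ => (r : ℂ)) hden
  simp only [ofReal_mul, hG0] at hden'
  rw [hgauss, hLξ, real_smul, real_smul] at hnum
  have hK : (K : ℂ) ≠ 0 := ofReal_ne_zero.2 (Real.exp_pos _).ne'
  have hdet' : ((|(LinearMap.det (act L).toLinearMap)⁻¹| : ℝ) : ℂ) ≠ 0 := ofReal_ne_zero.2 hdet
  have hZ : ((∫ x, Real.exp (-β * quadObjective H b c x) : ℝ) : ℂ) ≠ 0 := by
    intro h
    rw [h, mul_zero] at hden'
    exact mul_ne_zero hK hG0ne hden'.symm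
  have hcf : charFun (gibbs β (quadObjective H b c)) ξ =
      (∫ x, Real.exp (-β * quadObjective H b c x) • exp ((inner ℝ x ξ : ℝ) * I)) /
        ((∫ x, Real.exp (-β * quadObjective H b c x) : ℝ) : ℂ) := by
    rw [charFun_apply, gibbs, integral_tilted, div_eq_inv_mul, ← integral_const_mul]
    refine integral_congr_ae (.of_forall fun x => ?_)
    simp only [real_smul, ofReal_div]
    ring
  rw [hcf, div_eq_iff hZ, exp_add, ← mul_right_inj' hdet', hnum]
  have : -(inner ℝ ξ (act H⁻¹ ξ) / β) / 2 = -inner ℝ ξ (act H⁻¹ ξ) / (2 * β) := by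
    field_simp
  rw [this]
  linear_combination (-(exp ((inner ℝ ξ (act H⁻¹ b) : ℝ) * I) *
    exp (-inner ℝ ξ (act H⁻¹ ξ) / (2 * β) : ℝ))) * hden'

end Gibbs

/-! ### Second moment of the Gibbs measure -/

section Moment

open Complex

variable {d : ℕ} {H : Matrix (Fin d) (Fin d) ℝ}

theorem gibbs_quadObjective_eq_multivariateGaussian (hH : H.PosDef)
    (b : EuclideanSpace ℝ (Fin d)) (c : ℝ) {β : ℝ} (hβ : 0 < β) :
    gibbs β (quadObjective H b c) = multivariateGaussian (act H⁻¹ b) (β⁻¹ • H⁻¹) := by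
  have : IsFiniteMeasure (gibbs β (quadObjective H b c)) := by
    unfold gibbs
    infer_instance
  apply Measure.ext_of_charFun
  ext ξ
  rw [charFun_gibbs_quadObjective hH b c hβ,
    charFun_multivariateGaussian (hH.inv.smul (inv_pos.2 hβ)).posSemidef,
    ← Matrix.inner_toEuclideanCLM, map_smul, smul_apply, real_inner_smul_right]
  congr 1
  push_cast
  field_simp
  ring

theorem integral_norm_sub_sq_multivariateGaussian {S : Matrix (Fin d) (Fin d) ℝ}
    (hS : S.PosSemidef) (μ a : EuclideanSpace ℝ (Fin d)) :
    ∫ y, ‖a - y‖ ^ 2 ∂(multivariateGaussian μ S) = ‖a - μ‖ ^ 2 + S.trace := by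
  have hL2 : ∀ i, MemLp (fun y : EuclideanSpace ℝ (Fin d) => y i) 2 (multivariateGaussian μ S) :=
    fun i => (EuclideanSpace.proj i : EuclideanSpace ℝ (Fin d) →L[ℝ] ℝ).comp_memLp'
      IsGaussian.memLp_two_id
  have hL2' : ∀ i, MemLp (fun y : EuclideanSpace ℝ (Fin d) => a i - y i) 2
      (multivariateGaussian μ S) := fun i => (memLp_const (a i)).sub (hL2 i)
  have hmean : ∀ i, ∫ y, y i ∂(multivariateGaussian μ S) = μ i := fun i => by
    have h := (EuclideanSpace.proj i : EuclideanSpace ℝ (Fin d) →L[ℝ] ℝ).integral_comp_id_comm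
      (IsGaussian.integrable_id (μ := multivariateGaussian μ S))
    simpa using h
  have hcoord : ∀ i, ∫ y, (a i - y i) ^ 2 ∂(multivariateGaussian μ S) =
      (a i - μ i) ^ 2 + S i i := by
    intro i
    have h := variance_eq_sub (hL2' i)
    rw [variance_const_sub (hL2 i).aestronglyMeasurable,
      variance_eval_multivariateGaussian hS,
      integral_sub (integrable_const _) ((hL2 i).integrable (by norm_num)), hmean] at h
    simp only [integral_const, probReal_univ, one_smul, Pi.pow_apply] at h
    linarith
  simp only [EuclideanSpace.real_norm_sq_eq, PiLp.sub_apply]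
  rw [integral_finsetSum _ fun i _ => (hL2' i).integrable_sq]
  simp only [hcoord, Finset.sum_add_distrib, Matrix.trace, Matrix.diag]

/-- Each diagonal entry is `⟪eᵢ, H⁻¹ eᵢ⟫` for a unit vector. -/
theorem trace_inv_le (hd : 0 < d) (hH : H.PosDef) : H⁻¹.trace ≤ d / minEigenvalue H := by
  have h : ∀ i, H⁻¹ i i ≤ 1 / minEigenvalue H := by
    intro i
    have := inner_act_inv_le hd hH (EuclideanSpace.single i 1)
    rw [Matrix.inner_toEuclideanCLM] at this
    simpa using this
  refine (Finset.sum_le_sum fun i _ => h i).trans_eq ?_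
  simp [div_eq_mul_inv]

theorem lintegral_enorm_sub_sq_gibbs_le (hd : 0 < d) (hH : H.PosDef)
    (b x₀ : EuclideanSpace ℝ (Fin d)) (c : ℝ) {β : ℝ} (hβ : 0 < β) :
    ∫⁻ y, ‖x₀ - y‖ₑ ^ 2 ∂(gibbs β (quadObjective H b c)) ≤
      ENNReal.ofReal (2 * ‖x₀‖ ^ 2 + 4 / minEigenvalue H *
        (‖b‖ ^ 2 / (2 * minEigenvalue H) + d / β)) := by
  have hm := minEigenvalue_pos hd hH
  have hS := (hH.inv.smul (inv_pos.2 hβ)).posSemidef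
  rw [gibbs_quadObjective_eq_multivariateGaussian hH b c hβ]
  have hint : Integrable (fun y => ‖x₀ - y‖ ^ 2)
      (multivariateGaussian (act H⁻¹ b) (β⁻¹ • H⁻¹)) := by
    have h : MemLp (fun y => x₀ - y) 2 (multivariateGaussian (act H⁻¹ b) (β⁻¹ • H⁻¹)) :=
      (memLp_const x₀).sub IsGaussian.memLp_two_id
    exact h.integrable_norm_pow (by norm_num)
  have henorm : ∀ y, ‖x₀ - y‖ₑ ^ 2 = ENNReal.ofReal (‖x₀ - y‖ ^ 2) := fun y => by
    rw [ENNReal.ofReal_pow (norm_nonneg _), ofReal_norm]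
  simp only [henorm]
  rw [← ofReal_integral_eq_lintegral_ofReal hint (.of_forall fun y => by positivity),
    integral_norm_sub_sq_multivariateGaussian hS]
  refine ENNReal.ofReal_le_ofReal ?_
  have h₁ : ‖x₀ - act H⁻¹ b‖ ^ 2 ≤ 2 * ‖x₀‖ ^ 2 + 2 * ‖act H⁻¹ b‖ ^ 2 := by
    have := parallelogram_law_with_norm ℝ x₀ (act H⁻¹ b)
    nlinarith [norm_nonneg (x₀ + act H⁻¹ b)]
  have h₂ : ‖act H⁻¹ b‖ ^ 2 ≤ ‖b‖ ^ 2 / minEigenvalue H ^ 2 := by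
    rw [← div_pow]
    gcongr
    exact norm_act_inv_le hd hH b
  have h₃ : (β⁻¹ • H⁻¹).trace ≤ d / (β * minEigenvalue H) := by
    rw [Matrix.trace_smul, smul_eq_mul, ← div_div, div_right_comm, div_eq_inv_mul _ β]
    gcongr
    exact trace_inv_le hd hH
  -- The trace costs only one copy of `d / (β m)`; the target has four, so the others are dropped by
  -- sign.
  have h₄ : 0 ≤ (d : ℝ) / (β * minEigenvalue H) := by positivity
  have h₅ : 4 / minEigenvalue H * (‖b‖ ^ 2 / (2 * minEigenvalue H) + d / β) =
      2 * (‖b‖ ^ 2 / minEigenvalue H ^ 2) + 4 * (d / (β * minEigenvalue H)) := by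
    field_simp
    ring
  rw [h₅]
  linarith

end Moment

/-! ### The linear coupling -/

section Coupling

open Complex

variable {d : ℕ}

/-- A linear coupling of `ν` and `π`: if `x + R (y - a)` has law `π` for independent `x ∼ ν` and
`y ∼ π`, the Wasserstein distance is at most `‖R‖` times the `L²` distance of `π` to `a`. -/
theorem W2_le_of_map_prod {ν π : Measure (EuclideanSpace ℝ (Fin d))} [IsProbabilityMeasure ν]
    [IsProbabilityMeasure π]
    (R : EuclideanSpace ℝ (Fin d) →L[ℝ] EuclideanSpace ℝ (Fin d)) (a : EuclideanSpace ℝ (Fin d))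
    (h : (ν.prod π).map (fun p => p.1 + R (p.2 - a)) = π) {V : ℝ} (hV : 0 ≤ V)
    (hπ : ∫⁻ y, ‖a - y‖ₑ ^ 2 ∂π ≤ ENNReal.ofReal V) :
    W2 ν π ≤ ENNReal.ofReal (‖R‖ * √V) := by
  let γ := (ν.prod π).map fun p => (p.1, p.1 + R (p.2 - a))
  have hmeas : Measurable fun p : EuclideanSpace ℝ (Fin d) × EuclideanSpace ℝ (Fin d) =>
      (p.1, p.1 + R (p.2 - a)) := by fun_prop
  have hγ : γ.map Prod.fst = ν ∧ γ.map Prod.snd = π := by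
    constructor
    · rw [Measure.map_map measurable_fst hmeas]
      exact Measure.map_fst_prod.trans (by simp)
    · rw [Measure.map_map measurable_snd hmeas]
      exact h
  refine (iInf₂_le γ hγ).trans ?_
  have hbound : ∫⁻ p, ‖p.1 - p.2‖ₑ ^ 2 ∂γ ≤ ENNReal.ofReal ((‖R‖ * √V) ^ 2) := by
    rw [lintegral_map (by fun_prop) hmeas]
    calc ∫⁻ p, ‖p.1 - (p.1 + R (p.2 - a))‖ₑ ^ 2 ∂(ν.prod π)
        ≤ ∫⁻ p, ‖R‖ₑ ^ 2 * ‖a - p.2‖ₑ ^ 2 ∂(ν.prod π) := by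
          refine lintegral_mono fun p => ?_
          have : p.1 - (p.1 + R (p.2 - a)) = R (a - p.2) := by
            rw [sub_add_cancel_left, ← map_neg, neg_sub]
          rw [this, ← mul_pow]
          gcongr
          exact R.le_opENorm _
      _ = ‖R‖ₑ ^ 2 * ∫⁻ y, ‖a - y‖ₑ ^ 2 ∂π := by
          rw [lintegral_const_mul _ (by fun_prop), lintegral_prod _ (by fun_prop)]
          simp
      _ ≤ ‖R‖ₑ ^ 2 * ENNReal.ofReal V := by gcongr
      _ = ENNReal.ofReal ((‖R‖ * √V) ^ 2) := by
          rw [mul_pow, Real.sq_sqrt hV, ENNReal.ofReal_mul (by positivity),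
            ENNReal.ofReal_pow (norm_nonneg _), ofReal_norm]
  calc (∫⁻ p, ‖p.1 - p.2‖ₑ ^ 2 ∂γ) ^ (1 / 2 : ℝ)
      ≤ ENNReal.ofReal ((‖R‖ * √V) ^ 2) ^ (1 / 2 : ℝ) := by gcongr
    _ = ENNReal.ofReal (‖R‖ * √V) := by
        rw [ENNReal.ofReal_rpow_of_nonneg (by positivity) (by norm_num), ← Real.sqrt_eq_rpow,
          Real.sqrt_sq (by positivity)]

theorem charFun_map_prod_add_clm {ν π : Measure (EuclideanSpace ℝ (Fin d))}
    [IsProbabilityMeasure ν] [IsProbabilityMeasure π]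
    (R : EuclideanSpace ℝ (Fin d) →L[ℝ] EuclideanSpace ℝ (Fin d))
    (a ξ : EuclideanSpace ℝ (Fin d)) :
    charFun ((ν.prod π).map fun p => p.1 + R (p.2 - a)) ξ =
      charFun ν ξ * (exp ((-inner ℝ (R.adjoint ξ) a : ℝ) * I) * charFun π (R.adjoint ξ)) := by
  rw [charFun_apply, integral_map (by fun_prop) (by fun_prop), charFun_apply, charFun_apply,
    ← integral_const_mul, ← integral_prod_mul]
  refine integral_congr_ae (.of_forall fun p => ?_)
  simp only [← exp_add]
  congr 1
  rw [inner_add_left, map_sub, inner_sub_left, ← ContinuousLinearMap.adjoint_inner_right,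
    ← ContinuousLinearMap.adjoint_inner_right, real_inner_comm a]
  push_cast
  ring

/-- Running the stationary process with the same noise leaves the Gibbs measure invariant. -/
theorem IsNonReversibleLangevin.map_prod_eq_gibbs {Ω : Type*} [MeasurableSpace Ω] {P : Measure Ω}
    [IsProbabilityMeasure P] {H J : Matrix (Fin d) (Fin d) ℝ}
    {b x₀ : EuclideanSpace ℝ (Fin d)} {c β : ℝ} {B X : ℝ≥0 → Ω → EuclideanSpace ℝ (Fin d)}
    (hH : H.PosDef) (hJ : J.transpose = -J) (hβ : 0 < β) (hB : IsStandardBrownian B P)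
    (hX : IsNonReversibleLangevin J (quadObjective H b c) β x₀ B X P) (t : ℝ≥0)
    [IsProbabilityMeasure (gibbs β (quadObjective H b c))] :
    ((P.map (X t)).prod (gibbs β (quadObjective H b c))).map
      (fun p => p.1 + act (NormedSpace.exp ((-(t : ℝ)) • driftMatrix H J)) (p.2 - x₀)) =
      gibbs β (quadObjective H b c) := by
  have := Measure.isProbabilityMeasure_map (hX.aemeasurable t)
  apply Measure.ext_of_charFun
  ext ξ
  rw [charFun_map_prod_add_clm, hX.charFun_map hH hJ hβ hB t ξ rfl,
    charFun_gibbs_quadObjective hH b c hβ, charFun_gibbs_quadObjective hH b c hβ,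
    ← exp_add, ← exp_add]
  -- With `η = R† ξ`, the variance that `X t` lacks, `⟪η, H⁻¹ η⟫ / β`, is the one supplied by `R y`;
  -- the means in `η` cancel as well.
  congr 1
  rw [inner_sub_right]
  push_cast
  ring

end Coupling

end

end NonReversibleLangevin

open NonReversibleLangevin in
theorem theorem2 {d : ℕ} (hd : 0 < d) (H J : Matrix (Fin d) (Fin d) ℝ)
    (hH : H.PosDef) (hJ : J.transpose = -J) :
    (∃ C : ℝ, IsDecayConstant H J C) ∧
    ∀ C : ℝ, IsDecayConstant H J C →
      ∀ (b : EuclideanSpace ℝ (Fin d)) (c β : ℝ), 0 < β →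
      ∀ (Ω : Type*) [MeasurableSpace Ω] (P : Measure Ω) [IsProbabilityMeasure P]
        (B X : ℝ≥0 → Ω → EuclideanSpace ℝ (Fin d)) (x₀ : EuclideanSpace ℝ (Fin d)),
        IsStandardBrownian B P →
        IsNonReversibleLangevin J (quadObjective H b c) β x₀ B X P →
        ∀ t : ℝ≥0,
          W2 (P.map (X t)) (gibbs β (quadObjective H b c)) ≤
            ENNReal.ofReal
              (C * (1 + (t : ℝ) ^ (maxBlockSize (driftMatrix H J) - 1)) *
                Real.exp (-(t : ℝ) * minRealPart (driftMatrix H J)) *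
                √(2 * ‖x₀‖ ^ 2 + 4 / minEigenvalue H *
                    (‖b‖ ^ 2 / (2 * minEigenvalue H) + d / β))) := by
  refine ⟨exists_isDecayConstant H J, ?_⟩
  intro C hC b c β hβ Ω _ P _ B X x₀ hB hX t
  have hm := minEigenvalue_pos hd hH
  have hprob : IsProbabilityMeasure (gibbs β (quadObjective H b c)) := by
    rw [gibbs_quadObjective_eq_multivariateGaussian hH b c hβ]
    infer_instance
  have := Measure.isProbabilityMeasure_map (hX.aemeasurable t)
  refine (W2_le_of_map_prod _ x₀ (hX.map_prod_eq_gibbs hH hJ hβ hB t) (by positivity)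
    (lintegral_enorm_sub_sq_gibbs_le hd hH b x₀ c hβ)).trans (ENNReal.ofReal_le_ofReal ?_)
  gcongr
  exact hC.2 t t.coe_nonneg
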